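/- For $n\ge 1$ let $P_{\mathrm{MAT}}(n)\subseteq\mathbb{R}^{\binom{[n]}{2}}$ be the matching polytope of the complete graph $K_n$, i.e. the convex hull of the indicator vectors of all (not necessarily perfect) matchings of $K_n$. For a polytope $K$, let the extension complexity $\mathsf{xc}(K)$ be the minimal number of facets of a polytope $Q\subseteq\mathbb{R}^{d}$ (with $d$ arbitrary) such that $\pi(Q)=K$ for some linear map $\pi$. There is an absolute constant $0<\alpha<1$ such that for every $n\ge 1$, every real $\varepsilon$ with $\frac{2}{n}\le\varepsilon\le 1$, and every polytope $K$ with $$P_{\mathrm{MAT}}(n)\subseteq K\subseteq(1+\varepsilon)P_{\mathrm{MAT}}(n),$$ one has $$\mathsf{xc}(K)\ \ge\ \binom{n}{\lceil \alpha/\varepsilon\rceil}.$$ -/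

import Mathlib

open scoped Pointwise

/-- A polytope: the convex hull of a finite set of points. -/
def IsPolytope {E : Type*} [AddCommGroup E] [Module ℝ E] (P : Set E) : Prop :=
  ∃ s : Set E, s.Finite ∧ P = convexHull ℝ s

/-- `F` is a facet of `P`: a nonempty face of `P` (the set of maximizers over `P` of a linear
functional) whose dimension is one less than the dimension of `P`. The dimension of a set is that
of the direction of its affine span. -/
def IsFacet {d : ℕ} (P F : Set (Fin d → ℝ)) : Prop :=
  F.Nonempty ∧ IsExposed ℝ P F ∧
    Module.finrank ℝ (vectorSpan ℝ F) + 1 = Module.finrank ℝ (vectorSpan ℝ P)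

/-- The number of facets of `P`. -/
noncomputable def numFacets {d : ℕ} (P : Set (Fin d → ℝ)) : ℕ∞ :=
  {F : Set (Fin d → ℝ) | IsFacet P F}.encard

/-- The polytope `Q`, with the linear map `π`, is an extended formulation of `P`. -/
def IsExtendedFormulation {E : Type*} [AddCommGroup E] [Module ℝ E] {d : ℕ}
    (Q : Set (Fin d → ℝ)) (π : (Fin d → ℝ) →ₗ[ℝ] E) (P : Set E) : Prop :=
  IsPolytope Q ∧ π '' Q = P

/-- The extension complexity of `P`: the minimal number of facets of an extended formulation
of `P`. -/
noncomputable def extensionComplexity {E : Type*} [AddCommGroup E] [Module ℝ E]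
    (P : Set E) : ℕ∞ :=
  ⨅ (d : ℕ) (Q : Set (Fin d → ℝ)) (π : (Fin d → ℝ) →ₗ[ℝ] E)
    (_ : IsExtendedFormulation Q π P), numFacets Q

/-- The edges of the complete graph on `n` vertices. -/
abbrev CompleteEdge (n : ℕ) : Type := (⊤ : SimpleGraph (Fin n)).edgeSet

/-- The matching polytope of the complete graph on `n` vertices: the convex hull of the indicator
vectors of the edge sets of all (not necessarily perfect) matchings. -/
noncomputable def matchingPolytope (n : ℕ) : Set (CompleteEdge n → ℝ) :=
  convexHull ℝ {x | ∃ M : (⊤ : SimpleGraph (Fin n)).Subgraph, M.IsMatching ∧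
    x = Set.indicator {e : CompleteEdge n | (e : Sym2 (Fin n)) ∈ M.edgeSet} 1}

/-! By Yannakakis' argument (`IsExtendedFormulation.exists_factorization`), the facets of an
extended formulation of `K` write all slacks of `K` as sums of `r` products of nonnegative
functions. The slacks used are those of the odd set inequalities for `|U| = 2k + 3`, relaxed by `1 +
ε`, at matchings `M`. With `τ = ε (2k + 2)`, which is tiny, such a slack is `τ`, `2 + τ` or `4 + τ`
when `M` has `k + 1`, `k` or `k - 1` edges inside `U`.

Place an extra vertex, an extra cell (two vertices) and `k` rows of `B` cells at random among the
vertices. The set `U` consists of the extra vertex, the extra cell and one chosen cell per row; `M`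
consists of the edges of the paired cells, a cell of a row being paired in 15 of its 16 states. For
a single product `f U * g M`, the weight on slack `2 + τ` is bounded by a constant times the weight
on slack `τ`, plus a multiple of the weight on slack `4 + τ`, plus an exponentially small error
(`placed_pairedTotal_le`). Summed over the factorization, this is contradictory unless `r` is about
`exp (k c) / k` (`exp_le_card_factors`).

The inequality for one product is proved by entropy. If the weight is not exponentially small, the
chain rule shows that in most rows, given the choices in earlier rows and the states of later rows,
the chosen cell is spread out and the state of the row is nearly uniform
(`sum_sum_not_isTypical_le`). In such a context choice and state are independent, except that the
chosen cell must be paired. Now rotate the five vertices of the extra vertex, the extra cell and the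
chosen cell. This fixes `U`, and moves the edge of the chosen cell onto the extra cell. If two
consecutive placements of an orbit are both typical, there is substantial weight on slack `τ`
(`rowMass_le_of_swap`). Otherwise at most two of the five placements contribute. Since a single
chosen cell is 15 times rarer than a paired one, this compares 2 with `2/5 * 4` times a loss of
`(16/15)^2`, which is still below 2; the bias towards paired cells keeps that loss close to 1.

The deficit `c` per row may be as large as a small multiple of `log B`, where `B` is of order `n /
k`. With `k` a large multiple of `m = ⌈α / ε⌉`, the number `exp (k c)` becomes `B ^ (3 m)`, which
beats `n.choose m`. The case `m = 1` is a rank bound, `le_card_factors`. -/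

set_option linter.unusedSectionVars false

/-! ### Entropy and relative entropy of finite weights. -/

section Entropy

open Finset

/-- The inequality `log x ≤ x - 1` at `x = v / u`, in a form that survives `u = 0`. Every entropy
inequality below is a sum of instances of it. -/
lemma mul_log_sub_log_le {u v : ℝ} (hu : 0 ≤ u) (hv : 0 ≤ v) (h : v = 0 → u = 0) :
    u * (Real.log v - Real.log u) ≤ v - u := by
  rcases hu.eq_or_lt with rfl | hu'
  · simpa using hv
  have hv' : 0 < v := lt_of_le_of_ne hv fun h0 => hu'.ne' (h h0.symm)
  rw [← Real.log_div hv'.ne' hu'.ne']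
  have := Real.log_le_sub_one_of_pos (div_pos hv' hu')
  calc u * Real.log (v / u) ≤ u * (v / u - 1) := by gcongr
    _ = v - u := by field_simp

open Classical in
/-- The mass of the event `X = s` under the weight `P`. -/
noncomputable def marginal {Ω S : Type*} [Fintype Ω] (P : Ω → ℝ) (X : Ω → S)
    (s : S) : ℝ := ∑ ω, if X ω = s then P ω else 0

/-- The Shannon entropy of `X` under the weight `P`. -/
noncomputable def entropy {Ω S : Type*} [Fintype Ω] [Fintype S] (P : Ω → ℝ)
    (X : Ω → S) : ℝ := -∑ s, marginal P X s * Real.log (marginal P X s)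

variable {Ω S T R : Type*} [Fintype Ω] [Fintype S] [Fintype T] [Fintype R] {P : Ω → ℝ}

lemma marginal_nonneg (hP : ∀ ω, 0 ≤ P ω) (X : Ω → S) (s : S) : 0 ≤ marginal P X s :=
  sum_nonneg fun ω _ => by split_ifs <;> simp [hP]

lemma sum_marginal_mul (X : Ω → S) (φ : S → ℝ) :
    ∑ s, marginal P X s * φ s = ∑ ω, P ω * φ (X ω) := by
  classical
  simp only [marginal, sum_mul]
  rw [sum_comm]
  refine sum_congr rfl fun ω _ => ?_
  simp [ite_mul]

lemma sum_marginal (X : Ω → S) : ∑ s, marginal P X s = ∑ ω, P ω := by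
  simpa using sum_marginal_mul (P := P) X (fun _ => 1)

lemma sum_marginal_prod (X : Ω → S) (Y : Ω → T) (t : T) :
    ∑ s, marginal P (fun ω => (X ω, Y ω)) (s, t) = marginal P Y t := by
  classical
  simp only [marginal]
  rw [sum_comm]
  refine sum_congr rfl fun ω _ => ?_
  by_cases h : Y ω = t <;> simp [h]

lemma entropy_eq_sum (X : Ω → S) :
    entropy P X = -∑ ω, P ω * Real.log (marginal P X (X ω)) := by
  rw [entropy, sum_marginal_mul X (fun s => Real.log (marginal P X s))]

lemma entropy_congr (X : Ω → S) (Y : Ω → T) (h : ∀ ω ω', X ω = X ω' ↔ Y ω = Y ω') :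
    entropy P X = entropy P Y := by
  classical
  simp only [entropy_eq_sum, marginal, h]

lemma entropy_le_log_card (hP : ∀ ω, 0 ≤ P ω) (h1 : ∑ ω, P ω = 1) (X : Ω → S) :
    entropy P X ≤ Real.log (Fintype.card S) := by
  have hS : 0 < Fintype.card S := by
    have : Nonempty Ω := by
      by_contra h
      rw [not_nonempty_iff] at h
      simp at h1
    exact Fintype.card_pos_iff.2 ⟨X this.some⟩
  have hc : (0 : ℝ) < Fintype.card S := by exact_mod_cast hS
  have key := sum_le_sum (s := univ) fun s _ =>
    mul_log_sub_log_le (marginal_nonneg hP X s) (inv_pos.2 hc).le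
      (fun h => absurd h (inv_pos.2 hc).ne')
  simp only [mul_sub, sum_sub_distrib, ← sum_mul, sum_marginal, h1] at key
  simp only [sum_const, card_univ, nsmul_eq_mul, Real.log_inv] at key
  rw [mul_inv_cancel₀ hc.ne'] at key
  rw [entropy]
  linarith

lemma neg_log_le_entropy_of_injective (hP : ∀ ω, 0 ≤ P ω) (h1 : ∑ ω, P ω = 1) {X : Ω → S}
    (hX : Function.Injective X) {M : ℝ} (hM : ∀ ω, P ω ≤ M) : -Real.log M ≤ entropy P X := by
  rw [entropy_eq_sum, neg_le_neg_iff]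
  calc ∑ ω, P ω * Real.log (marginal P X (X ω)) ≤ ∑ ω, P ω * Real.log M := by
        refine sum_le_sum fun ω _ => ?_
        have : marginal P X (X ω) = P ω := by
          classical simp [marginal, hX.eq_iff]
        rw [this]
        rcases (hP ω).eq_or_lt with h | h
        · simp [← h]
        · exact mul_le_mul_of_nonneg_left (Real.log_le_log h (hM ω)) h.le
    _ = Real.log M := by rw [← sum_mul, h1, one_mul]

/-- Conditional mutual information is nonnegative: compare `p x y z` with the conditionally
independent weight `p(x,z) p(y,z) / p(z)`, whose total is at most that of `p`. -/
lemma submodular_aux (p : S → T → R → ℝ) (hp : ∀ x y z, 0 ≤ p x y z) :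
    ∑ x, ∑ y, ∑ z, p x y z * (Real.log (∑ y', p x y' z) + Real.log (∑ x', p x' y z)
      - Real.log (p x y z) - Real.log (∑ x', ∑ y', p x' y' z)) ≤ 0 := by
  have hz : ∀ z, 0 ≤ ∑ x', ∑ y', p x' y' z := fun z =>
    sum_nonneg fun _ _ => sum_nonneg fun _ _ => hp _ _ _
  have hxz : ∀ x z, 0 ≤ ∑ y', p x y' z := fun x z => sum_nonneg fun _ _ => hp _ _ _
  have hyz : ∀ y z, 0 ≤ ∑ x', p x' y z := fun y z => sum_nonneg fun _ _ => hp _ _ _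
  have hle1 : ∀ x y z, p x y z ≤ ∑ y', p x y' z := fun x y z =>
    single_le_sum (f := fun y' => p x y' z) (fun _ _ => hp _ _ _) (mem_univ y)
  have hle2 : ∀ x y z, p x y z ≤ ∑ x', p x' y z := fun x y z =>
    single_le_sum (f := fun x' => p x' y z) (fun _ _ => hp _ _ _) (mem_univ x)
  have hle3 : ∀ x z, ∑ y', p x y' z ≤ ∑ x', ∑ y', p x' y' z := fun x z =>
    single_le_sum (f := fun x' => ∑ y', p x' y' z) (fun _ _ => hxz _ _) (mem_univ x)
  have step : ∀ x y z, p x y z * (Real.log (∑ y', p x y' z) + Real.log (∑ x', p x' y z)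
      - Real.log (p x y z) - Real.log (∑ x', ∑ y', p x' y' z)) ≤
      (∑ y', p x y' z) * (∑ x', p x' y z) / (∑ x', ∑ y', p x' y' z) - p x y z := by
    intro x y z
    rcases (hp x y z).eq_or_lt with h | h
    · rw [← h]
      have := div_nonneg (mul_nonneg (hxz x z) (hyz y z)) (hz z)
      simpa using this
    have h1 := h.trans_le (hle1 x y z)
    have h2 := h.trans_le (hle2 x y z)
    have h3 := h1.trans_le (hle3 x z)
    have h4 : 0 < (∑ y', p x y' z) * (∑ x', p x' y z) / (∑ x', ∑ y', p x' y' z) := by positivity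
    refine le_trans (le_of_eq ?_) (mul_log_sub_log_le h.le h4.le fun h0 => absurd h0 h4.ne')
    rw [Real.log_div (mul_pos h1 h2).ne' h3.ne', Real.log_mul h1.ne' h2.ne']
    ring
  refine (sum_le_sum fun x _ => sum_le_sum fun y _ => sum_le_sum fun z _ => step x y z).trans ?_
  simp only [sum_sub_distrib]
  rw [sub_nonpos]
  have e1 : ∀ q : S → T → R → ℝ, ∑ x, ∑ y, ∑ z, q x y z = ∑ z, ∑ x, ∑ y, q x y z := fun q => by
    rw [sum_comm' (t' := univ) (s' := fun _ => univ) (by simp)]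
    simp_rw [sum_comm (s := (univ : Finset T))]
    simp_rw [sum_comm (s := (univ : Finset S)) (t := (univ : Finset R))]
  rw [e1, e1 p]
  refine sum_le_sum fun z _ => ?_
  simp only [← sum_div, ← mul_sum, ← sum_mul]
  rw [sum_comm (f := fun y x' => p x' y z)]
  rcases (hz z).eq_or_lt with h | h
  · rw [← h]; simp
  · rw [mul_div_assoc, div_self h.ne', mul_one]

lemma entropy_submodular (hP : ∀ ω, 0 ≤ P ω) (X : Ω → S) (Y : Ω → T) (Z : Ω → R) :
    entropy P (fun ω => (X ω, Y ω, Z ω)) + entropy P Z ≤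
      entropy P (fun ω => (X ω, Z ω)) + entropy P (fun ω => (Y ω, Z ω)) := by
  have key := submodular_aux (fun x y z => marginal P (fun ω => (X ω, Y ω, Z ω)) (x, y, z))
    fun x y z => marginal_nonneg hP _ _
  have e1 : ∀ x z, ∑ y, marginal P (fun ω => (X ω, Y ω, Z ω)) (x, y, z) =
      marginal P (fun ω => (X ω, Z ω)) (x, z) := fun x z => by
    classical
    simp only [marginal]
    rw [sum_comm]
    refine sum_congr rfl fun ω _ => ?_
    by_cases h : X ω = x <;> by_cases h' : Z ω = z <;> simp [h, h']
  have e2 : ∀ y z, ∑ x, marginal P (fun ω => (X ω, Y ω, Z ω)) (x, y, z) =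
      marginal P (fun ω => (Y ω, Z ω)) (y, z) := fun y z => sum_marginal_prod _ _ _
  simp only [e1, e2, sum_marginal_prod] at key
  have e3 : ∀ φ : S × T × R → ℝ,
      ∑ x, ∑ y, ∑ z, marginal P (fun ω => (X ω, Y ω, Z ω)) (x, y, z) * φ (x, y, z) =
        ∑ ω, P ω * φ (X ω, Y ω, Z ω) := fun φ => by
    rw [← sum_marginal_mul (fun ω => (X ω, Y ω, Z ω)) φ]
    simp only [Fintype.sum_prod_type]
  rw [e3 (fun s => Real.log (marginal P (fun ω => (X ω, Z ω)) (s.1, s.2.2)) +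
    Real.log (marginal P (fun ω => (Y ω, Z ω)) s.2)
      - Real.log (marginal P (fun ω => (X ω, Y ω, Z ω)) s) - Real.log (marginal P Z s.2.2))] at key
  simp only [mul_add, mul_sub, sum_add_distrib, sum_sub_distrib] at key
  simp only [entropy_eq_sum]
  linarith

/-- The relative entropy, with respect to the uniform distribution on `s`, of the unnormalized
weight `u` on `s`. -/
noncomputable def relEntropy (s : Finset S) (u : S → ℝ) : ℝ :=
  ∑ x ∈ s, u x * Real.log (u x) - (∑ x ∈ s, u x) * Real.log (∑ x ∈ s, u x)
    + (∑ x ∈ s, u x) * Real.log s.card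

lemma relEntropy_congr {s : Finset S} {u v : S → ℝ} (h : ∀ x ∈ s, u x = v x) :
    relEntropy s u = relEntropy s v := by
  rw [relEntropy, relEntropy, sum_congr rfl h,
    sum_congr (g := fun x => v x * Real.log (v x)) rfl fun x hx => by rw [h x hx]]

/-- The Donsker–Varadhan inequality: compare `u` with the Gibbs weight proportional to `exp φ` of
the same mass. It turns a small relative entropy into bounds on expectations. -/
lemma sum_mul_le_relEntropy_add (s : Finset S) (u φ : S → ℝ) (hu : ∀ x, 0 ≤ u x) :
    ∑ x ∈ s, u x * φ x ≤ relEntropy s u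
      + (∑ x ∈ s, u x) * Real.log ((∑ x ∈ s, Real.exp (φ x)) / s.card) := by
  rcases s.eq_empty_or_nonempty with rfl | hs
  · simp [relEntropy]
  have hc : (0 : ℝ) < s.card := by exact_mod_cast hs.card_pos
  set m := ∑ x ∈ s, u x with hm
  set E := ∑ x ∈ s, Real.exp (φ x) with hE
  have hE0 : 0 < E := sum_pos (fun _ _ => Real.exp_pos _) hs
  have hm0 : 0 ≤ m := sum_nonneg fun x _ => hu x
  rcases hm0.eq_or_lt with h0 | h0
  · have : ∀ x ∈ s, u x = 0 := fun x hx =>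
      (sum_eq_zero_iff_of_nonneg fun x _ => hu x).1 (hm.symm.trans h0.symm) x hx
    have e : ∑ x ∈ s, u x * φ x = 0 := sum_eq_zero fun x hx => by simp [this x hx]
    have e' : ∑ x ∈ s, u x * Real.log (u x) = 0 := sum_eq_zero fun x hx => by simp [this x hx]
    rw [relEntropy, e, e', ← hm, ← h0]; simp
  have key := sum_le_sum (s := s) fun x _ =>
    mul_log_sub_log_le (hu x) (show 0 ≤ Real.exp (φ x) * (m / E) by positivity)
      (fun h => absurd h (by positivity))
  have e : ∀ x ∈ s, u x * (Real.log (Real.exp (φ x) * (m / E)) - Real.log (u x)) =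
      u x * φ x + u x * (Real.log m - Real.log E) - u x * Real.log (u x) := fun x _ => by
    rw [Real.log_mul (Real.exp_pos _).ne' (by positivity), Real.log_exp,
      Real.log_div h0.ne' hE0.ne']
    ring
  rw [sum_congr rfl e] at key
  simp only [sum_sub_distrib, sum_add_distrib, ← sum_mul, ← hm, ← hE] at key
  rw [mul_div_cancel₀ _ hE0.ne', sub_self] at key
  rw [relEntropy, Real.log_div hE0.ne' hc.ne', ← hm]
  linarith

lemma relEntropy_nonneg (s : Finset S) (u : S → ℝ) (hu : ∀ x, 0 ≤ u x) : 0 ≤ relEntropy s u := by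
  rcases s.eq_empty_or_nonempty with rfl | hs
  · simp [relEntropy]
  have hc : (s.card : ℝ) ≠ 0 := by exact_mod_cast hs.card_pos.ne'
  have := sum_mul_le_relEntropy_add s u 0 hu
  simpa [div_self hc] using this

lemma relEntropy_smul (s : Finset S) (u : S → ℝ) {c : ℝ} (hc : 0 < c)
    (hu : ∀ x, 0 ≤ u x) : relEntropy s (fun x => c * u x) = c * relEntropy s u := by
  have e1 : ∀ x ∈ s, c * u x * Real.log (c * u x) =
      c * (u x * Real.log (u x)) + u x * (c * Real.log c) := fun x _ => by
    rcases (hu x).eq_or_lt with h | h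
    · simp [← h]
    · rw [Real.log_mul hc.ne' h.ne']; ring
  have hm : 0 ≤ ∑ x ∈ s, u x := sum_nonneg fun x _ => hu x
  rw [relEntropy, relEntropy, sum_congr rfl e1, sum_add_distrib, ← mul_sum, ← mul_sum, ← sum_mul]
  rcases hm.eq_or_lt with h | h
  · simp [← h]
  · rw [Real.log_mul hc.ne' h.ne']; ring

/-- The entropy deficit of `X` given `Z`, relative to a fixed support of `X` for each value
of `Z`, is a sum of relative entropies. -/
lemma sum_relEntropy_eq (h1 : ∑ ω, P ω = 1) (X : Ω → S) (Z : Ω → R) (s : R → Finset S) {N : ℕ}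
    (hs : ∀ z, (s z).card = N) (hsupp : ∀ ω, X ω ∉ s (Z ω) → P ω = 0) :
    ∑ z, relEntropy (s z) (fun x => marginal P (fun ω => (X ω, Z ω)) (x, z)) =
      Real.log N - (entropy P (fun ω => (X ω, Z ω)) - entropy P Z) := by
  have h0 : ∀ z, ∀ x ∉ s z, marginal P (fun ω => (X ω, Z ω)) (x, z) = 0 := fun z x hx =>
    sum_eq_zero fun ω _ => by
      by_cases h : (X ω, Z ω) = (x, z)
      · obtain ⟨rfl, rfl⟩ := Prod.mk.inj h
        simp [hsupp ω hx]
      · rw [if_neg h]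
  have hm : ∀ z, ∑ x ∈ s z, marginal P (fun ω => (X ω, Z ω)) (x, z) = marginal P Z z := fun z => by
    rw [← sum_marginal_prod X Z z]
    exact sum_subset (subset_univ _) fun x _ hx => h0 z x hx
  have hl : ∀ z, ∑ x ∈ s z, marginal P (fun ω => (X ω, Z ω)) (x, z) *
      Real.log (marginal P (fun ω => (X ω, Z ω)) (x, z)) =
      ∑ x, marginal P (fun ω => (X ω, Z ω)) (x, z) *
      Real.log (marginal P (fun ω => (X ω, Z ω)) (x, z)) := fun z =>
    sum_subset (subset_univ _) fun x _ hx => by rw [h0 z x hx, zero_mul]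
  simp only [relEntropy, hm, hl, hs, sum_add_distrib, sum_sub_distrib, ← sum_mul, sum_marginal, h1]
  rw [entropy, entropy, Fintype.sum_prod_type, sum_comm]
  ring

end Entropy

/-! ### A single row: consequences of small entropy deficit. -/

section Row

open Finset

variable {B : ℕ}

/-- The states of a row of `B` cells in which cell `i` is paired (nonzero). -/
def pairedAt (i : Fin B) : Finset (Fin B → Fin 16) := univ.filter fun β => β i ≠ 0

/-- The states of a row of `B` cells in which cell `i` is single (zero). -/
def singleAt (i : Fin B) : Finset (Fin B → Fin 16) := univ.filter fun β => β i = 0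

lemma pairedAt_eq_piFinset (i : Fin B) :
    pairedAt i = Fintype.piFinset fun x => if x = i then {0}ᶜ else univ := by
  ext β
  simp only [pairedAt, mem_filter, mem_univ, true_and, Fintype.mem_piFinset]
  constructor
  · intro h x
    split_ifs with hx
    · subst hx; simpa using h
    · simp
  · intro h
    simpa using h i

lemma sum_pairedAt_prod (i : Fin B) (S : Finset (Fin B)) (hi : i ∉ S) (θ : ℝ) :
    ∑ β ∈ pairedAt i, ∏ x ∈ S, (if β x = 0 then θ else 1) =
      (pairedAt i).card * ((15 + θ) / 16) ^ S.card := by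
  have e : ∀ β : Fin B → Fin 16, ∏ x ∈ S, (if β x = 0 then θ else 1) =
      ∏ x, (if x ∈ S then (if β x = 0 then θ else 1) else 1) := fun β => by
    rw [prod_ite_mem, univ_inter]
  simp only [e]
  rw [pairedAt_eq_piFinset, Fintype.card_piFinset]
  rw [← Finset.prod_univ_sum (fun x => if x = i then {0}ᶜ else univ)
    (fun x c => if x ∈ S then (if c = 0 then θ else 1) else 1)]
  push_cast
  rw [← prod_const ((15 + θ) / 16)]
  rw [show ∏ _x ∈ S, ((15 + θ) / 16) = ∏ x, (if x ∈ S then (15 + θ) / 16 else 1) by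
    rw [prod_ite_mem, univ_inter]]
  rw [← prod_mul_distrib]
  refine prod_congr rfl fun x _ => ?_
  by_cases hx : x ∈ S
  · have hxi : x ≠ i := fun h => hi (h ▸ hx)
    simp only [hx, hxi, if_true, if_false]
    rw [Fin.sum_univ_succ]
    simp [Fin.succ_ne_zero]
    ring
  · simp [hx]

/-- The mass of the states in which cell `i` is paired. -/
noncomputable def pairedMass (w : (Fin B → Fin 16) → ℝ) (i : Fin B) : ℝ := ∑ β ∈ pairedAt i, w β

/-- The mass of the states in which cell `i` is single. -/
noncomputable def singleMass (w : (Fin B → Fin 16) → ℝ) (i : Fin B) : ℝ := ∑ β ∈ singleAt i, w β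

/-- The mass of the states in which cell `i` is paired and cell `x` is single. -/
noncomputable def pairedSingleMass (w : (Fin B → Fin 16) → ℝ) (i x : Fin B) : ℝ :=
  ∑ β ∈ pairedAt i, if β x = 0 then w β else 0

/-- The mass of the states in which cells `i` and `x` are paired. -/
noncomputable def pairedPairedMass (w : (Fin B → Fin 16) → ℝ) (i x : Fin B) : ℝ :=
  ∑ β ∈ pairedAt i, if β x ≠ 0 then w β else 0

variable {w : (Fin B → Fin 16) → ℝ} {α : Fin B → ℝ}

lemma pairedMass_nonneg (hw : ∀ β, 0 ≤ w β) (i : Fin B) : 0 ≤ pairedMass w i :=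
  sum_nonneg fun β _ => hw β

lemma pairedSingleMass_add_pairedPairedMass (i x : Fin B) :
    pairedSingleMass w i x + pairedPairedMass w i x = pairedMass w i := by
  rw [pairedSingleMass, pairedPairedMass, pairedMass, ← sum_add_distrib]
  refine sum_congr rfl fun β _ => ?_
  by_cases h : β x = 0 <;> simp [h]

lemma pairedSingleMass_le_singleMass (hw : ∀ β, 0 ≤ w β) (i x : Fin B) :
    pairedSingleMass w i x ≤ singleMass w x := by
  rw [pairedSingleMass, ← sum_filter, singleMass]
  refine sum_le_sum_of_subset_of_nonneg (fun β hβ => ?_) fun β _ _ => hw β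
  simpa [singleAt] using (mem_filter.1 hβ).2

/-- The test function is `l` times the number of single cells in `S`. As `i ∉ S`, its exponential
moment under the uniform distribution on `pairedAt i` factors over the cells. -/
lemma mul_sum_pairedSingleMass_le (hw : ∀ β, 0 ≤ w β) (i : Fin B) (S : Finset (Fin B))
    (hi : i ∉ S) (l : ℝ) :
    l * ∑ x ∈ S, pairedSingleMass w i x ≤
      relEntropy (pairedAt i) w + pairedMass w i * (S.card * ((Real.exp l - 1) / 16)) := by
  have key := sum_mul_le_relEntropy_add (pairedAt i) w
    (fun β => ∑ x ∈ S, if β x = 0 then l else 0) hw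
  have hc : (0 : ℝ) < (pairedAt i).card := by
    have : (fun _ => 1 : Fin B → Fin 16) ∈ pairedAt i := by simp [pairedAt]
    exact_mod_cast card_pos.2 ⟨_, this⟩
  have e1 : ∑ β ∈ pairedAt i, w β * ∑ x ∈ S, (if β x = 0 then l else 0) =
      l * ∑ x ∈ S, pairedSingleMass w i x := by
    simp only [pairedSingleMass, mul_sum]
    rw [sum_comm]
    refine sum_congr rfl fun x _ => sum_congr rfl fun β _ => ?_
    split_ifs <;> ring
  have e2 : ∑ β ∈ pairedAt i, Real.exp (∑ x ∈ S, if β x = 0 then l else 0) =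
      (pairedAt i).card * ((15 + Real.exp l) / 16) ^ S.card := by
    rw [← sum_pairedAt_prod i S hi]
    refine sum_congr rfl fun β _ => ?_
    rw [Real.exp_sum]
    refine prod_congr rfl fun x _ => ?_
    split_ifs <;> simp
  rw [e1, e2, mul_div_cancel_left₀ _ hc.ne', Real.log_pow] at key
  have hpos : 0 < (15 + Real.exp l) / 16 := by positivity
  have hlog : Real.log ((15 + Real.exp l) / 16) ≤ (Real.exp l - 1) / 16 :=
    (Real.log_le_sub_one_of_pos hpos).trans (le_of_eq (by ring))
  have := mul_le_mul_of_nonneg_left (mul_le_mul_of_nonneg_left hlog (Nat.cast_nonneg S.card))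
    (pairedMass_nonneg hw i)
  exact key.trans (add_le_add_right this _)

/-- The cells whose state is far from uniform, conditionally on cell `i` being paired. -/
noncomputable def badCells (w : (Fin B → Fin 16) → ℝ) (i : Fin B) : Finset (Fin B) :=
  univ.filter fun x => x = i ∨ pairedSingleMass w i x < 15 / 256 * pairedMass w i ∨
    pairedPairedMass w i x < 1 / 2 * pairedMass w i

/-- Each bad cell costs a fixed amount of relative entropy, because under the uniform distribution
the cells other than `i` are independent and single with probability `1/16`. The bound `15/256` is
`15/16` of that probability. -/
lemma card_badCells_le (hw : ∀ β, 0 ≤ w β) (i : Fin B) {d : ℝ} (hd : 0 ≤ d)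
    (h : relEntropy (pairedAt i) w ≤ d * pairedMass w i) :
    ((badCells w i).card : ℝ) ≤ 1 + 8195 * d := by
  set m := pairedMass w i with hm
  rcases (pairedMass_nonneg hw i).eq_or_lt with h0 | h0
  · have hz : ∀ x, pairedSingleMass w i x = 0 ∧ pairedPairedMass w i x = 0 := fun x => by
      have h1 := pairedSingleMass_add_pairedPairedMass (w := w) i x
      have h2 : 0 ≤ pairedSingleMass w i x :=
        sum_nonneg fun β _ => by split_ifs <;> simp [hw]
      have h3 : 0 ≤ pairedPairedMass w i x :=
        sum_nonneg fun β _ => by split_ifs <;> simp [hw]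
      constructor <;> linarith
    have : badCells w i = {i} := by
      ext x
      simp [badCells, hz, ← h0]
    rw [this]
    simp
    positivity
  set S1 := univ.filter fun x => x ≠ i ∧ pairedSingleMass w i x < 15 / 256 * m with hS1
  set S2 := univ.filter fun x => x ≠ i ∧ pairedPairedMass w i x < 1 / 2 * m with hS2
  have hsub : badCells w i ⊆ insert i (S1 ∪ S2) := by
    intro x hx
    simp only [badCells, mem_filter, mem_univ, true_and] at hx
    simp only [hS1, hS2, mem_insert, mem_union, mem_filter, mem_univ, true_and]
    by_cases hxi : x = i
    · exact Or.inl hxi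
    · rcases hx with hx | hx | hx
      · exact Or.inl hx
      · exact Or.inr (Or.inl ⟨hxi, hx⟩)
      · exact Or.inr (Or.inr ⟨hxi, hx⟩)
  have h1 : (S1.card : ℝ) ≤ 8192 * d := by
    -- The tilt `-1/16` gains `31/8192 - 15/4096 = 1/8192` per cell of `S1`, whence the factor 8192.
    have key := mul_sum_pairedSingleMass_le hw i S1 (by simp [hS1]) (-(1 / 16))
    have hle : ∑ x ∈ S1, pairedSingleMass w i x ≤ S1.card * (15 / 256 * m) := by
      rw [← nsmul_eq_mul]
      exact sum_le_card_nsmul _ _ _ fun x hx => (mem_filter.1 hx).2.2.le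
    have he : Real.exp (-(1 / 16)) - 1 ≤ -(31 / 512) := by
      have h2 := Real.quadratic_le_exp_of_nonneg (show (0 : ℝ) ≤ 1 / 16 by norm_num)
      rw [Real.exp_neg]
      have : (Real.exp (1 / 16))⁻¹ ≤ (545 / 512 : ℝ)⁻¹ := by
        apply inv_anti₀ (by norm_num)
        refine le_trans (by norm_num) h2
      refine (sub_le_sub_right this 1).trans (by norm_num)
    have h3 : m * (S1.card * ((Real.exp (-(1 / 16)) - 1) / 16)) ≤
        m * (S1.card * (-(31 / 512) / 16)) := by gcongr
    have h4 : (S1.card : ℝ) * m ≤ 8192 * d * m := by nlinarith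
    exact le_of_mul_le_mul_right h4 h0
  have h2 : (S2.card : ℝ) ≤ 3 * d := by
    -- The tilt `1` gains at least `1/2 - 1/8 = 3/8` per cell of `S2`.
    have key := mul_sum_pairedSingleMass_le hw i S2 (by simp [hS2]) 1
    have hle : S2.card * (1 / 2 * m) ≤ ∑ x ∈ S2, pairedSingleMass w i x := by
      rw [← nsmul_eq_mul]
      refine card_nsmul_le_sum _ _ _ fun x hx => ?_
      have h5 := pairedSingleMass_add_pairedPairedMass (w := w) i x
      have h6 := (mem_filter.1 hx).2.2
      linarith
    have he : Real.exp 1 - 1 ≤ 2 := by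
      have := Real.exp_one_lt_d9
      linarith
    have h3 : m * (S2.card * ((Real.exp 1 - 1) / 16)) ≤ m * (S2.card * (2 / 16)) := by gcongr
    have h4 : (S2.card : ℝ) * m ≤ 3 * d * m := by nlinarith
    exact le_of_mul_le_mul_right h4 h0
  have h3 : ((badCells w i).card : ℝ) ≤ 1 + (S1.card + S2.card) := by
    have := (card_le_card hsub).trans ((card_insert_le _ _).trans
      (Nat.add_le_add_right (card_union_le _ _) 1))
    have : ((badCells w i).card : ℝ) ≤ S1.card + S2.card + 1 := by exact_mod_cast this
    linarith
  linarith

/-- The cells on whose being paired the states of few cells depend. -/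
noncomputable def goodCells (D : ℝ) (w : (Fin B → Fin 16) → ℝ) : Finset (Fin B) :=
  univ.filter fun i => ((badCells w i).card : ℝ) ≤ D

/-- The total weight of the choices of a cell `i` and of a state in which `i` is paired. -/
noncomputable def rowMass (α : Fin B → ℝ) (w : (Fin B → Fin 16) → ℝ) : ℝ :=
  ∑ i, α i * pairedMass w i

/-- A cell is typical if the weight is spread over the cells, mostly over good cells, and its
state is close to uniform conditionally on the heaviest good cell being paired. -/
def IsTypical (D : ℝ) (α : Fin B → ℝ) (w : (Fin B → Fin 16) → ℝ) (i : Fin B) : Prop :=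
  (∀ S : Finset (Fin B), (S.card : ℝ) ≤ D →
    ∑ x ∈ S, α x * pairedMass w x ≤ rowMass α w / 200) ∧
  ∑ x ∈ (goodCells D w)ᶜ, α x * pairedMass w x ≤ rowMass α w / 200 ∧
  i ∈ goodCells D w ∧
  ∃ y ∈ goodCells D w, (∀ x ∈ goodCells D w, pairedMass w x ≤ pairedMass w y) ∧
    i ∉ badCells w y

/-- A set with few elements has small weight: tilting by `l` on `S` at most doubles the uniform
mean, because `D * exp l ≤ B`, so `l` times the weight of `S` is at most `t + 1` times the total. -/
lemma sum_le_of_relEntropy_le {u : Fin B → ℝ} (hu : ∀ i, 0 ≤ u i) {D t l : ℝ}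
    (ht : 0 ≤ t) (hl : 200 * (t + 1) ≤ l) (hD : D * Real.exp l ≤ B)
    (h : relEntropy univ u ≤ t * ∑ i, u i) (S : Finset (Fin B)) (hS : (S.card : ℝ) ≤ D) :
    ∑ i ∈ S, u i ≤ (∑ i, u i) / 200 := by
  rcases Nat.eq_zero_or_pos B with rfl | hB
  · simp [eq_empty_of_isEmpty S]
  have hB' : (0 : ℝ) < B := by exact_mod_cast hB
  have key := sum_mul_le_relEntropy_add univ u (fun i => if i ∈ S then l else 0) hu
  have e1 : ∑ i, u i * (if i ∈ S then l else 0) = l * ∑ i ∈ S, u i := by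
    simp [mul_ite, sum_ite_mem, mul_sum, mul_comm]
  have e2 : ∑ i : Fin B, Real.exp (if i ∈ S then l else 0) ≤ B + S.card * Real.exp l := by
    calc ∑ i : Fin B, Real.exp (if i ∈ S then l else 0)
        ≤ ∑ i : Fin B, (1 + if i ∈ S then Real.exp l else 0) := by
          refine sum_le_sum fun i _ => ?_
          split_ifs
          · linarith
          · simp
      _ = B + S.card * Real.exp l := by simp [sum_add_distrib]
  have e3 : (∑ i : Fin B, Real.exp (if i ∈ S then l else 0)) / (univ : Finset (Fin B)).card ≤ 2 := by
    rw [card_univ, Fintype.card_fin, div_le_iff₀ hB']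
    have : S.card * Real.exp l ≤ D * Real.exp l := by gcongr
    linarith
  have hm : 0 ≤ ∑ i, u i := sum_nonneg fun i _ => hu i
  have e4 : Real.log ((∑ i : Fin B, Real.exp (if i ∈ S then l else 0)) /
      (univ : Finset (Fin B)).card) ≤ 1 := by
    have hpos : 0 < (∑ i : Fin B, Real.exp (if i ∈ S then l else 0)) /
      (univ : Finset (Fin B)).card := by
      have : Nonempty (Fin B) := ⟨⟨0, hB⟩⟩
      have : 0 < ∑ i : Fin B, Real.exp (if i ∈ S then l else 0) :=
        sum_pos (fun _ _ => Real.exp_pos _) univ_nonempty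
      rw [card_univ, Fintype.card_fin]
      positivity
    have := Real.log_le_sub_one_of_pos hpos
    linarith
  rw [e1] at key
  have h5 : l * ∑ i ∈ S, u i ≤ (t + 1) * ∑ i, u i := by
    have := mul_le_mul_of_nonneg_left e4 hm
    linarith
  have h6 : 0 ≤ ∑ i ∈ S, u i := sum_nonneg fun i _ => hu i
  have h7 : 200 * (t + 1) * ∑ i ∈ S, u i ≤ l * ∑ i ∈ S, u i := by gcongr
  have h8 : (t + 1) * (200 * ∑ i ∈ S, u i) ≤ (t + 1) * ∑ i, u i := by linarith
  have := le_of_mul_le_mul_left h8 (by linarith)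
  linarith

open Classical in
/-- The atypical part of the weight of a row is controlled by its entropy deficits. -/
lemma sum_not_isTypical_le (hα : ∀ i, 0 ≤ α i) (hw : ∀ β, 0 ≤ w β) {D t l t' : ℝ}
    (ht : 0 < t) (ht' : 0 < t') (hl : 200 * (t + 1) ≤ l) (hD : D * Real.exp l ≤ B)
    (hD' : 1 + 8195 * (200 * t') ≤ D) :
    ∑ i, (if IsTypical D α w i then 0 else α i * pairedMass w i) ≤
      relEntropy univ (fun i => α i * pairedMass w i) / t +
      (∑ i, relEntropy (pairedAt i) (fun β => α i * w β)) / t' + rowMass α w / 100 := by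
  have hu : ∀ i, 0 ≤ α i * pairedMass w i := fun i => mul_nonneg (hα i) (pairedMass_nonneg hw i)
  have hm : 0 ≤ rowMass α w := sum_nonneg fun i _ => hu i
  have hA := relEntropy_nonneg univ _ hu
  have hBi : ∀ i, 0 ≤ relEntropy (pairedAt i) (fun β => α i * w β) := fun i =>
    relEntropy_nonneg _ _ fun β => mul_nonneg (hα i) (hw β)
  have hB : 0 ≤ ∑ i, relEntropy (pairedAt i) (fun β => α i * w β) := sum_nonneg fun i _ => hBi i
  have htriv : ∑ i, (if IsTypical D α w i then 0 else α i * pairedMass w i) ≤ rowMass α w :=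
    sum_le_sum fun i _ => by split_ifs <;> simp [hu i]
  have hA' := div_nonneg hA ht.le
  have hB' := div_nonneg hB ht'.le
  -- Markov-type splitting: a row whose deficit exceeds `t` or `t'` times its mass is charged in
  -- full to that deficit.
  by_cases h1 : relEntropy univ (fun i => α i * pairedMass w i) ≤ t * rowMass α w
  swap
  · have : rowMass α w ≤ relEntropy univ (fun i => α i * pairedMass w i) / t := by
      rw [le_div_iff₀ ht]; linarith
    linarith
  by_cases h2 : ∑ i, relEntropy (pairedAt i) (fun β => α i * w β) ≤ t' * rowMass α w
  swap
  · have : rowMass α w ≤ (∑ i, relEntropy (pairedAt i) (fun β => α i * w β)) / t' := by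
      rw [le_div_iff₀ ht']; linarith
    linarith
  rcases hm.eq_or_lt with h0 | h0
  · linarith
  have hspread := sum_le_of_relEntropy_le hu ht.le hl hD h1
  -- By `card_badCells_le`, a cell that is not good has a deficit above `200 * t'` times its mass,
  -- so such cells carry at most `1/200` of the weight.
  have hgood : ∑ x ∈ (goodCells D w)ᶜ, α x * pairedMass w x ≤ rowMass α w / 200 := by
    have h3 : (200 * t') * ∑ x ∈ (goodCells D w)ᶜ, α x * pairedMass w x ≤
        ∑ i, relEntropy (pairedAt i) (fun β => α i * w β) := by
      rw [mul_sum]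
      refine (sum_le_sum fun x hx => ?_).trans
        (sum_le_sum_of_subset_of_nonneg (subset_univ (goodCells D w)ᶜ) fun i _ _ => hBi i)
      rcases (hα x).eq_or_lt with hx0 | hx0
      · simpa [← hx0] using hBi x
      rw [relEntropy_smul _ _ hx0 hw]
      have hx' : ¬ ((badCells w x).card : ℝ) ≤ D := by simpa [goodCells] using hx
      have : ¬ relEntropy (pairedAt x) w ≤ 200 * t' * pairedMass w x := fun h =>
        hx' ((card_badCells_le hw x (by positivity) h).trans hD')
      have := mul_le_mul_of_nonneg_left (not_le.1 this).le hx0.le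
      linarith
    have h4 : t' * (200 * ∑ x ∈ (goodCells D w)ᶜ, α x * pairedMass w x) ≤ t' * rowMass α w := by
      linarith
    have := le_of_mul_le_mul_left h4 ht'
    linarith
  have hne : (goodCells D w).Nonempty := by
    by_contra hne
    rw [not_nonempty_iff_eq_empty] at hne
    rw [hne, compl_empty] at hgood
    change rowMass α w ≤ _ at hgood
    linarith
  -- The cell `y` serves as reference: it bounds the mass of every good cell, and all cells outside
  -- the few bad cells of `y` are single with about the expected frequency.
  obtain ⟨y, hy, hymax⟩ := exists_max_image (goodCells D w) (pairedMass w) hne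
  have hyD : ((badCells w y).card : ℝ) ≤ D := (mem_filter.1 hy).2
  have h5 : ∑ i, (if IsTypical D α w i then 0 else α i * pairedMass w i) ≤
      ∑ i ∈ (goodCells D w)ᶜ, α i * pairedMass w i + ∑ i ∈ badCells w y, α i * pairedMass w i := by
    rw [← sum_compl_add_sum (goodCells D w)]
    refine add_le_add (sum_le_sum fun i _ => by split_ifs <;> simp [hu i]) ?_
    calc ∑ i ∈ goodCells D w, (if IsTypical D α w i then 0 else α i * pairedMass w i)
        ≤ ∑ i ∈ goodCells D w, if i ∈ badCells w y then α i * pairedMass w i else 0 := by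
          refine sum_le_sum fun i hi => ?_
          by_cases hib : i ∈ badCells w y
          · rw [if_pos hib]
            split_ifs <;> simp [hu i]
          · rw [if_pos ⟨hspread, hgood, hi, y, hy, hymax, hib⟩, if_neg hib]
      _ ≤ ∑ i, if i ∈ badCells w y then α i * pairedMass w i else 0 :=
          sum_le_sum_of_subset_of_nonneg (subset_univ _) fun i _ _ => by split_ifs <;> simp [hu i]
      _ = ∑ i ∈ badCells w y, α i * pairedMass w i := by simp [sum_ite_mem]
  have := hspread _ hyD
  change _ ≤ rowMass α w / 200 at this
  linarith

end Row

/-! ### Conditioning on the earlier choices and the later states. -/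

section Context

open Finset

variable {k B : ℕ}

/-- The function on `Fin k` given by its values before `j`, at `j` and after `j`. -/
def glue {X : Type*} (j : Fin k) (l : {x // x < j} → X) (y : X) (r : {x // j < x} → X) :
    Fin k → X :=
  fun x => if h : x < j then l ⟨x, h⟩ else if h' : j < x then r ⟨x, h'⟩ else y

lemma glue_lt {X : Type*} {j : Fin k} (l : {x // x < j} → X) (y : X) (r : {x // j < x} → X)
    {x : Fin k} (h : x < j) : glue j l y r x = l ⟨x, h⟩ := by simp [glue, h]

lemma glue_gt {X : Type*} {j : Fin k} (l : {x // x < j} → X) (y : X) (r : {x // j < x} → X)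
    {x : Fin k} (h : j < x) : glue j l y r x = r ⟨x, h⟩ := by simp [glue, h, h.not_gt]

lemma glue_self {X : Type*} {j : Fin k} (l : {x // x < j} → X) (y : X) (r : {x // j < x} → X) :
    glue j l y r j = y := by simp [glue]

/-- Splitting a function on `Fin k` into its values before `j`, at `j` and after `j`. -/
def splitEquiv (X : Type*) (j : Fin k) :
    (Fin k → X) ≃ ({x // x < j} → X) × X × ({x // j < x} → X) where
  toFun f := (fun x => f x, f j, fun x => f x)
  invFun p := glue j p.1 p.2.1 p.2.2
  left_inv f := by
    ext x
    rcases lt_trichotomy x j with h | h | h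
    · simp [glue_lt _ _ _ h]
    · subst h; simp [glue_self]
    · simp [glue_gt _ _ _ h]
  right_inv p := by
    refine Prod.ext ?_ (Prod.ext ?_ ?_)
    · ext x; simp [glue_lt _ _ _ x.2]
    · simp [glue_self]
    · ext x; simp [glue_gt _ _ _ x.2]

/-- The choices in the rows before `j` together with the states of the rows after `j`. -/
abbrev Context (k B : ℕ) (j : Fin k) : Type :=
  ({x // x < j} → Fin B) × ({x // j < x} → Fin B → Fin 16)

/-- The context of row `j` for the choices `a` and the states `b`. -/
def context (j : Fin k) (a : Fin k → Fin B) (b : Fin k → Fin B → Fin 16) : Context k B j :=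
  (fun x => a x, fun x => b x)

/-- The total weight of the choices in a context that choose a given cell in row `j`. -/
noncomputable def choiceWeight (F : (Fin k → Fin B) → ℝ) (j : Fin k) (z : Context k B j)
    (i : Fin B) : ℝ :=
  ∑ r : {x // j < x} → Fin B, if ∀ x, z.2 x (r x) ≠ 0 then F (glue j z.1 i r) else 0

/-- The total weight of the states in a context that have a given state in row `j`. -/
noncomputable def stateWeight (G : (Fin k → Fin B → Fin 16) → ℝ) (j : Fin k) (z : Context k B j)
    (β : Fin B → Fin 16) : ℝ :=
  ∑ l : {x // x < j} → Fin B → Fin 16, if ∀ x, l x (z.1 x) ≠ 0 then G (glue j l β z.2) else 0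

lemma sum_rearrange {R L Y R' : Type*} [Fintype R] [Fintype L] [Fintype Y] [Fintype R']
    (T : R → L → Y → R' → ℝ) :
    ∑ r, ∑ l, ∑ y, ∑ r', T r l y r' = ∑ r', ∑ y, ∑ r, ∑ l, T r l y r' := by
  calc ∑ r, ∑ l, ∑ y, ∑ r', T r l y r' = ∑ r, ∑ l, ∑ r', ∑ y, T r l y r' :=
        sum_congr rfl fun r _ => sum_congr rfl fun l _ => sum_comm
    _ = ∑ r, ∑ r', ∑ l, ∑ y, T r l y r' := sum_congr rfl fun r _ => sum_comm
    _ = ∑ r', ∑ r, ∑ l, ∑ y, T r l y r' := sum_comm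
    _ = ∑ r', ∑ r, ∑ y, ∑ l, T r l y r' :=
        sum_congr rfl fun r' _ => sum_congr rfl fun r _ => sum_comm
    _ = _ := sum_congr rfl fun r' _ => sum_comm

/-- In each context of row `j` the choices and the states in row `j` are independent. -/
lemma sum_eq_sum_context (F : (Fin k → Fin B) → ℝ) (G : (Fin k → Fin B → Fin 16) → ℝ) (j : Fin k)
    (φ : Context k B j → Fin B → (Fin B → Fin 16) → ℝ) :
    ∑ a : Fin k → Fin B, ∑ b : Fin k → Fin B → Fin 16,
      (if ∀ x, x ≠ j → b x (a x) ≠ 0 then F a * G b * φ (context j a b) (a j) (b j) else 0) =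
    ∑ z, ∑ i, ∑ β, choiceWeight F j z i * stateWeight G j z β * φ z i β := by
  rw [← (splitEquiv (Fin B) j).symm.sum_comp]
  simp_rw [← (splitEquiv (Fin B → Fin 16) j).symm.sum_comp]
  simp only [Fintype.sum_prod_type]
  refine sum_congr rfl fun l _ => ?_
  rw [sum_comm (s := (univ : Finset ({x // j < x} → Fin B → Fin 16)))]
  refine sum_congr rfl fun i _ => ?_
  rw [sum_rearrange]
  refine sum_congr rfl fun r' _ => sum_congr rfl fun β _ => ?_
  -- The conditions in later rows involve only the later choices, as the later states are fixed;
  -- those in earlier rows involve only the earlier states. Hence the sum factors.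
  rw [choiceWeight, stateWeight, sum_mul_sum, sum_mul]
  refine sum_congr rfl fun r _ => ?_
  rw [sum_mul]
  refine sum_congr rfl fun l' _ => ?_
  have hc : context j ((splitEquiv (Fin B) j).symm (l, i, r))
      ((splitEquiv (Fin B → Fin 16) j).symm (l', β, r')) = (l, r') := by
    refine Prod.ext ?_ ?_
    · ext x; simp [context, splitEquiv, glue_lt _ _ _ x.2]
    · ext x; simp [context, splitEquiv, glue_gt _ _ _ x.2]
  have hiff : (∀ x, x ≠ j → (splitEquiv (Fin B → Fin 16) j).symm (l', β, r') x
      ((splitEquiv (Fin B) j).symm (l, i, r) x) ≠ 0) ↔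
      (∀ x, r' x (r x) ≠ 0) ∧ (∀ x, l' x (l x) ≠ 0) := by
    constructor
    · intro h
      refine ⟨fun x => ?_, fun x => ?_⟩
      · have := h x x.2.ne'
        simpa [splitEquiv, glue_gt _ _ _ x.2] using this
      · have := h x x.2.ne
        simpa [splitEquiv, glue_lt _ _ _ x.2] using this
    · rintro ⟨h1, h2⟩ x hx
      rcases lt_or_gt_of_ne hx with h | h
      · simpa [splitEquiv, glue_lt _ _ _ h] using h2 ⟨x, h⟩
      · simpa [splitEquiv, glue_gt _ _ _ h] using h1 ⟨x, h⟩
  rw [hc]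
  simp only [hiff]
  have e1 : (splitEquiv (Fin B) j).symm (l, i, r) j = i := by simp [splitEquiv, glue_self]
  have e2 : (splitEquiv (Fin B → Fin 16) j).symm (l', β, r') j = β := by
    simp [splitEquiv, glue_self]
  rw [e1, e2]
  by_cases h1 : ∀ x, r' x (r x) ≠ 0
  · by_cases h2 : ∀ x, l' x (l x) ≠ 0
    · rw [if_pos ⟨h1, h2⟩, if_pos h1, if_pos h2]; rfl
    · rw [if_neg (fun h => h2 h.2), if_neg h2]; ring
  · rw [if_neg (fun h => h1 h.1), if_neg h1]; ring

/-- The total weight of the pairs of choices and states in which every chosen cell is paired. -/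
noncomputable def pairedTotal (F : (Fin k → Fin B) → ℝ) (G : (Fin k → Fin B → Fin 16) → ℝ) : ℝ :=
  ∑ a : Fin k → Fin B, ∑ b : Fin k → Fin B → Fin 16,
    if ∀ x, b x (a x) ≠ 0 then F a * G b else 0

/-- The total weight of the pairs of choices and states in which the chosen cell is single in
row `j` and paired in the other rows. -/
noncomputable def singleTotal (F : (Fin k → Fin B) → ℝ) (G : (Fin k → Fin B → Fin 16) → ℝ)
    (j : Fin k) : ℝ :=
  ∑ a : Fin k → Fin B, ∑ b : Fin k → Fin B → Fin 16,
    if (∀ x, x ≠ j → b x (a x) ≠ 0) ∧ b j (a j) = 0 then F a * G b else 0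

lemma paired_iff (j : Fin k) (a : Fin k → Fin B) (b : Fin k → Fin B → Fin 16) :
    (∀ x, b x (a x) ≠ 0) ↔ (∀ x, x ≠ j → b x (a x) ≠ 0) ∧ b j (a j) ≠ 0 := by
  constructor
  · exact fun h => ⟨fun x _ => h x, h j⟩
  · rintro ⟨h, hj⟩ x
    by_cases hx : x = j
    · exact hx ▸ hj
    · exact h x hx

lemma sum_paired_eq_sum_context (F : (Fin k → Fin B) → ℝ) (G : (Fin k → Fin B → Fin 16) → ℝ)
    (j : Fin k) (φ : Context k B j → Fin B → (Fin B → Fin 16) → ℝ) :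
    ∑ a : Fin k → Fin B, ∑ b : Fin k → Fin B → Fin 16,
      (if ∀ x, b x (a x) ≠ 0 then F a * G b * φ (context j a b) (a j) (b j) else 0) =
    ∑ z, ∑ i, ∑ β ∈ pairedAt i, choiceWeight F j z i * stateWeight G j z β * φ z i β := by
  have key := sum_eq_sum_context F G j (fun z i β => if β i ≠ 0 then φ z i β else 0)
  calc _ = _ := sum_congr rfl fun a _ => sum_congr rfl fun b _ => by
        simp only [paired_iff j a b, mul_ite, mul_zero, ite_and]
    _ = _ := key
    _ = _ := by
        refine sum_congr rfl fun z _ => sum_congr rfl fun i _ => ?_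
        rw [pairedAt, sum_filter]
        exact sum_congr rfl fun β _ => by simp only [mul_ite, mul_zero]

lemma pairedTotal_eq (F : (Fin k → Fin B) → ℝ) (G : (Fin k → Fin B → Fin 16) → ℝ) (j : Fin k) :
    pairedTotal F G = ∑ z, rowMass (choiceWeight F j z) (stateWeight G j z) := by
  have key := sum_paired_eq_sum_context F G j (fun _ _ _ => 1)
  simp only [mul_one] at key
  rw [pairedTotal, key]
  simp only [rowMass, pairedMass, mul_sum]

lemma singleTotal_eq (F : (Fin k → Fin B) → ℝ) (G : (Fin k → Fin B → Fin 16) → ℝ) (j : Fin k) :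
    singleTotal F G j =
      ∑ z, ∑ i, choiceWeight F j z i * singleMass (stateWeight G j z) i := by
  have key := sum_eq_sum_context F G j (fun z i β => if β i = 0 then 1 else 0)
  calc _ = _ := sum_congr rfl fun a _ => sum_congr rfl fun b _ => by
        simp only [mul_ite, mul_zero, ite_and, mul_one]
    _ = _ := key
    _ = _ := by
        refine sum_congr rfl fun z _ => sum_congr rfl fun i _ => ?_
        rw [singleMass, singleAt, mul_sum, sum_filter]
        exact sum_congr rfl fun β _ => by simp only [mul_ite, mul_zero, mul_one]

lemma choiceWeight_nonneg {F : (Fin k → Fin B) → ℝ} (hF : ∀ a, 0 ≤ F a) (j : Fin k)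
    (z : Context k B j) (i : Fin B) : 0 ≤ choiceWeight F j z i :=
  sum_nonneg fun r _ => by split_ifs <;> simp [hF]

lemma stateWeight_nonneg {G : (Fin k → Fin B → Fin 16) → ℝ} (hG : ∀ b, 0 ≤ G b) (j : Fin k)
    (z : Context k B j) (β : Fin B → Fin 16) : 0 ≤ stateWeight G j z β :=
  sum_nonneg fun r _ => by split_ifs <;> simp [hG]

lemma card_pairedAt (i : Fin B) : (pairedAt i).card = 15 * 16 ^ (B - 1) := by
  rw [pairedAt_eq_piFinset, Fintype.card_piFinset, ← mul_prod_erase univ _ (mem_univ i)]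
  rw [prod_congr rfl (g := fun _ => 16)]
  · simp [card_compl]
  · intro x hx
    simp [(mem_erase.1 hx).1]

end Context

/-! ### The chain rule: most of a large weight is typical. -/

section EntropyBound

open Finset

variable {k B : ℕ}

/-- The values of `f` at the indices satisfying `p`. -/
def maskWith {X : Type*} (p : Fin k → Prop) [DecidablePred p] (f : Fin k → X) :
    Fin k → Option X := fun x => if p x then some (f x) else none

lemma maskWith_eq_iff {X : Type*} {p : Fin k → Prop} [DecidablePred p] {f g : Fin k → X} :
    maskWith p f = maskWith p g ↔ ∀ x, p x → f x = g x := by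
  simp only [funext_iff, maskWith]
  refine forall_congr' fun x => ?_
  by_cases h : p x <;> simp [h]

lemma context_eq_iff {j : Fin k} {a a' : Fin k → Fin B} {b b' : Fin k → Fin B → Fin 16} :
    context j a b = context j a' b' ↔ (∀ x, x < j → a x = a' x) ∧ (∀ x, j < x → b x = b' x) := by
  simp only [context, Prod.mk.injEq]
  rw [funext_iff, funext_iff]
  simp [Subtype.forall]

variable {P : (Fin k → Fin B) × (Fin k → Fin B → Fin 16) → ℝ}

/-- The chain rule for the choices given all states, row by row from the first. The states and the
earlier choices determine the context, and conditioning on less only increases entropy. -/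
lemma sum_entropy_choice_ge (hP : ∀ ω, 0 ≤ P ω) :
    entropy P (fun ω => ω) - entropy P (fun ω => ω.2) ≤
      ∑ j : Fin k, (entropy P (fun ω => (ω.1 j, context j ω.1 ω.2)) -
        entropy P (fun ω => context j ω.1 ω.2)) := by
  set h : ℕ → ℝ := fun t => entropy P (fun ω => (maskWith (fun x => x.1 < t) ω.1, ω.2)) with hh
  have h0 : h 0 = entropy P (fun ω => ω.2) := entropy_congr _ _ fun ω ω' => by
    simp [maskWith_eq_iff, Prod.ext_iff]
  have hk : h k = entropy P (fun ω => ω) := entropy_congr _ _ fun ω ω' => by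
    rw [Prod.ext_iff, Prod.ext_iff, maskWith_eq_iff]
    exact ⟨fun h => ⟨funext fun x => h.1 x x.2, h.2⟩, fun h => ⟨fun x _ => by rw [h.1], h.2⟩⟩
  rw [← h0, ← hk, ← sum_range_sub h k, ← Fin.sum_univ_eq_sum_range (fun t => h (t + 1) - h t)]
  refine sum_le_sum fun j _ => ?_
  have key := entropy_submodular hP (fun ω => ω.1 j) (fun ω => ω.2)
    (fun ω => context j ω.1 ω.2)
  have e1 : entropy P (fun ω => (ω.1 j, ω.2, context j ω.1 ω.2)) = h (j + 1) :=
    entropy_congr _ _ fun ω ω' => by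
      simp only [Prod.mk.injEq, maskWith_eq_iff, context_eq_iff]
      constructor
      · rintro ⟨h1, h2, h3, -⟩
        refine ⟨fun x hx => ?_, h2⟩
        rcases Nat.lt_succ_iff_lt_or_eq.1 hx with hx | hx
        · exact h3 x hx
        · exact (Fin.ext hx : x = j) ▸ h1
      · rintro ⟨h1, h2⟩
        exact ⟨h1 j (Nat.lt_succ_self _), h2, fun x hx => h1 x (Nat.lt_succ_of_lt hx),
          fun x _ => by rw [h2]⟩
  have e2 : entropy P (fun ω => (ω.2, context j ω.1 ω.2)) = h j :=
    entropy_congr _ _ fun ω ω' => by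
      simp only [Prod.mk.injEq, maskWith_eq_iff, context_eq_iff]
      constructor
      · rintro ⟨h2, h3, -⟩
        exact ⟨h3, h2⟩
      · rintro ⟨h1, h2⟩
        exact ⟨h2, h1, fun x _ => by rw [h2]⟩
  linarith

/-- The chain rule for the states given all choices, this time from the last row to the first, so
that what is already revealed determines the context. The sign in `h` lets it telescope upwards. -/
lemma sum_entropy_state_ge (hP : ∀ ω, 0 ≤ P ω) :
    entropy P (fun ω => ω) - entropy P (fun ω => ω.1) ≤
      ∑ j : Fin k, (entropy P (fun ω => (ω.2 j, ω.1 j, context j ω.1 ω.2)) -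
        entropy P (fun ω => (ω.1 j, context j ω.1 ω.2))) := by
  set h : ℕ → ℝ := fun t => -entropy P (fun ω => (ω.1, maskWith (fun x => t ≤ x.1) ω.2)) with hh
  have h0 : -h 0 = entropy P (fun ω => ω) := by
    rw [hh, neg_neg]
    refine entropy_congr _ _ fun ω ω' => ?_
    rw [Prod.ext_iff, Prod.ext_iff, maskWith_eq_iff]
    exact ⟨fun h => ⟨h.1, funext fun x => h.2 x (Nat.zero_le _)⟩,
      fun h => ⟨h.1, fun x _ => by rw [h.2]⟩⟩
  have hk : -h k = entropy P (fun ω => ω.1) := by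
    rw [hh, neg_neg]
    refine entropy_congr _ _ fun ω ω' => ?_
    simp [maskWith_eq_iff, Prod.ext_iff, Nat.not_le.2 (Fin.is_lt _)]
  have ht : entropy P (fun ω => ω) - entropy P (fun ω => ω.1) = h k - h 0 := by
    rw [← h0, ← hk]; ring
  rw [ht, ← sum_range_sub h k, ← Fin.sum_univ_eq_sum_range (fun t => h (t + 1) - h t)]
  refine sum_le_sum fun j _ => ?_
  have key := entropy_submodular hP (fun ω => ω.2 j) (fun ω => ω.1)
    (fun ω => (ω.1 j, context j ω.1 ω.2))
  have e1 : entropy P (fun ω => (ω.2 j, ω.1, ω.1 j, context j ω.1 ω.2)) = -h j := by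
    rw [hh, neg_neg]
    refine entropy_congr _ _ fun ω ω' => ?_
    simp only [Prod.mk.injEq, maskWith_eq_iff, context_eq_iff]
    constructor
    · rintro ⟨h1, h2, -, -, h3⟩
      refine ⟨h2, fun x hx => ?_⟩
      rcases Nat.eq_or_lt_of_le hx with hx | hx
      · exact (Fin.ext hx : j = x) ▸ h1
      · exact h3 x hx
    · rintro ⟨h1, h2⟩
      exact ⟨h2 j le_rfl, h1, by rw [h1], fun x _ => by rw [h1], fun x hx => h2 x (le_of_lt hx)⟩
  have e2 : entropy P (fun ω => (ω.1, ω.1 j, context j ω.1 ω.2)) = -h (j + 1) := by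
    rw [hh, neg_neg]
    refine entropy_congr _ _ fun ω ω' => ?_
    simp only [Prod.mk.injEq, maskWith_eq_iff, context_eq_iff]
    constructor
    · rintro ⟨h1, -, -, h3⟩
      exact ⟨h1, h3⟩
    · rintro ⟨h1, h2⟩
      exact ⟨h1, by rw [h1], fun x _ => by rw [h1], h2⟩
  linarith

variable {F : (Fin k → Fin B) → ℝ} {G : (Fin k → Fin B → Fin 16) → ℝ}

open Classical in
/-- If the paired pairs have large total weight, then most of it is typical. -/
lemma sum_sum_not_isTypical_le (hB : 0 < B) (hF : ∀ a, 0 ≤ F a) (hF1 : ∀ a, F a ≤ 1)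
    (hG : ∀ b, 0 ≤ G b) (hG1 : ∀ b, G b ≤ 1) {D l c : ℝ} (hc : 0 < c)
    (hl : 200 * (200 * (c + 1) + 1) ≤ l) (hD : D * Real.exp l ≤ B)
    (hD' : 1 + 8195 * (200 * (200 * c)) ≤ D)
    (hZ : Real.exp (-(k * c)) * (B * (15 * 16 ^ (B - 1))) ^ k ≤ pairedTotal F G) :
    ∑ j : Fin k, ∑ z, ∑ i,
      (if IsTypical D (choiceWeight F j z) (stateWeight G j z) i then 0
        else choiceWeight F j z i * pairedMass (stateWeight G j z) i) ≤
      k * pairedTotal F G / 50 := by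
  set Z := pairedTotal F G with hZdef
  have hB' : (0 : ℝ) < B := by exact_mod_cast hB
  have hZ0 : 0 < Z := lt_of_lt_of_le (by positivity) hZ
  set P : (Fin k → Fin B) × (Fin k → Fin B → Fin 16) → ℝ := fun ω =>
    if ∀ x, ω.2 x (ω.1 x) ≠ 0 then F ω.1 * G ω.2 * Z⁻¹ else 0 with hPdef
  have hP : ∀ ω, 0 ≤ P ω := fun ω => by
    rw [hPdef]
    dsimp only
    split_ifs
    · exact mul_nonneg (mul_nonneg (hF _) (hG _)) (inv_nonneg.2 hZ0.le)
    · exact le_rfl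
  have hPle : ∀ ω, P ω ≤ Z⁻¹ := fun ω => by
    rw [hPdef]
    dsimp only
    split_ifs
    · have h1 : F ω.1 * G ω.2 ≤ 1 := mul_le_one₀ (hF1 _) (hG _) (hG1 _)
      exact mul_le_of_le_one_left (inv_nonneg.2 hZ0.le) h1
    · exact inv_nonneg.2 hZ0.le
  have hP1 : ∑ ω, P ω = 1 := by
    rw [Fintype.sum_prod_type, hPdef]
    have : ∀ a b, (if ∀ x, b x (a x) ≠ 0 then F a * G b * Z⁻¹ else 0) =
        (if ∀ x, b x (a x) ≠ 0 then F a * G b else 0) * Z⁻¹ := fun a b => by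
      rw [ite_mul, zero_mul]
    simp only [this, ← sum_mul]
    exact mul_inv_cancel₀ hZ0.ne'
  have hsum : ∀ (j : Fin k) (φ : Context k B j → Fin B → (Fin B → Fin 16) → ℝ),
      ∑ ω, P ω * φ (context j ω.1 ω.2) (ω.1 j) (ω.2 j) = Z⁻¹ *
      ∑ z, ∑ i, ∑ β ∈ pairedAt i, choiceWeight F j z i * stateWeight G j z β * φ z i β := by
    intro j φ
    rw [← sum_paired_eq_sum_context, Fintype.sum_prod_type, mul_sum]
    refine sum_congr rfl fun a _ => ?_
    rw [mul_sum]
    refine sum_congr rfl fun b _ => ?_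
    rw [hPdef]
    dsimp only
    split_ifs
    · ring
    · ring
  have hmA : ∀ (j : Fin k) i z, marginal P (fun ω => (ω.1 j, context j ω.1 ω.2)) (i, z) =
      Z⁻¹ * (choiceWeight F j z i * pairedMass (stateWeight G j z) i) := by
    intro j i z
    have := hsum j (fun z' i' _ => if (i', z') = (i, z) then 1 else 0)
    simp only [mul_ite, mul_one, mul_zero] at this
    rw [marginal]
    refine ((sum_congr rfl fun ω _ => by congr).trans this).trans ?_
    congr 1
    rw [sum_eq_single z, sum_eq_single i]
    · simp [pairedMass, mul_sum]
    · intro i' _ h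
      simp [h]
    · simp
    · intro z' _ h
      simp [h]
    · simp
  have hmB : ∀ (j : Fin k) i z, ∀ β ∈ pairedAt i,
      marginal P (fun ω => (ω.2 j, ω.1 j, context j ω.1 ω.2)) (β, i, z) =
      Z⁻¹ * (choiceWeight F j z i * stateWeight G j z β) := by
    intro j i z β hβ
    have := hsum j (fun z' i' β' => if (β', i', z') = (β, i, z) then 1 else 0)
    simp only [mul_ite, mul_one, mul_zero] at this
    rw [marginal]
    refine ((sum_congr rfl fun ω _ => by congr).trans this).trans ?_
    congr 1
    rw [sum_eq_single z, sum_eq_single i, sum_eq_single β]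
    · simp
    · intro β' _ h
      simp [h]
    · exact fun h => absurd hβ h
    · intro i' _ h
      simp [h]
    · simp
    · intro z' _ h
      simp [h]
    · simp
  have hZi : 0 < Z⁻¹ := inv_pos.2 hZ0
  have hcw := fun j => choiceWeight_nonneg hF (B := B) (k := k) j
  have hsw := fun j => stateWeight_nonneg hG (B := B) (k := k) j
  have hklA : ∀ j : Fin k, Z⁻¹ * ∑ z, relEntropy univ
      (fun i => choiceWeight F j z i * pairedMass (stateWeight G j z) i) =
      Real.log B - (entropy P (fun ω => (ω.1 j, context j ω.1 ω.2)) -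
        entropy P (fun ω => context j ω.1 ω.2)) := by
    intro j
    rw [← sum_relEntropy_eq hP1 (fun ω => ω.1 j) (fun ω => context j ω.1 ω.2) (fun _ => univ)
      (N := B) (by simp) (by simp), mul_sum]
    refine sum_congr rfl fun z _ => ?_
    rw [← relEntropy_smul _ _ hZi
      (fun i => mul_nonneg (hcw j z i) (pairedMass_nonneg (hsw j z) i))]
    congr 1
    ext i
    rw [hmA]
  have hklB : ∀ j : Fin k, Z⁻¹ * ∑ z, ∑ i, relEntropy (pairedAt i)
      (fun β => choiceWeight F j z i * stateWeight G j z β) =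
      Real.log (15 * 16 ^ (B - 1) : ℕ) -
        (entropy P (fun ω => (ω.2 j, ω.1 j, context j ω.1 ω.2)) -
        entropy P (fun ω => (ω.1 j, context j ω.1 ω.2))) := by
    intro j
    rw [← sum_relEntropy_eq hP1 (fun ω => ω.2 j) (fun ω => (ω.1 j, context j ω.1 ω.2))
      (fun p => pairedAt p.1) (N := 15 * 16 ^ (B - 1)) (fun p => card_pairedAt _)
      (fun ω hω => ?_)]
    · rw [sum_comm, mul_sum, Fintype.sum_prod_type (f := fun p : Fin B × Context k B j =>
        relEntropy (pairedAt p.1) fun β =>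
          marginal P (fun ω => (ω.2 j, ω.1 j, context j ω.1 ω.2)) (β, p))]
      refine sum_congr rfl fun i _ => ?_
      rw [mul_sum]
      refine sum_congr rfl fun z _ => ?_
      rw [← relEntropy_smul _ _ hZi (fun β => mul_nonneg (hcw j z i) (hsw j z β))]
      exact relEntropy_congr fun β hβ => (hmB j i z β hβ).symm
    · rw [hPdef]
      dsimp only
      rw [if_neg]
      intro h
      exact hω (by simpa [pairedAt] using h j)
  have hN : (0 : ℝ) < 15 * 16 ^ (B - 1) := by positivity
  -- No pair has probability above `Z⁻¹`, and `Z` is at least `exp (-(k c))` times the number of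
  -- paired pairs.
  have hent : k * Real.log B + k * Real.log (15 * 16 ^ (B - 1)) - k * c ≤
      entropy P (fun ω => ω) := by
    have h1 := neg_log_le_entropy_of_injective hP hP1 (X := fun ω => ω) Function.injective_id hPle
    rw [Real.log_inv, neg_neg] at h1
    have h2 := Real.log_le_log (by positivity) hZ
    rw [Real.log_mul (by positivity) (by positivity), Real.log_exp, Real.log_pow,
      Real.log_mul hB'.ne' hN.ne'] at h2
    linarith
  have hentA : entropy P (fun ω => ω.1) ≤ k * Real.log B := by
    have := entropy_le_log_card hP hP1 (fun ω => ω.1)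
    simpa [Real.log_pow] using this
  have hentB : entropy P (fun ω => ω.2) ≤ k * (B * Real.log 16) := by
    have := entropy_le_log_card hP hP1 (fun ω => ω.2)
    simpa [Real.log_pow] using this
  -- The entropy of the states is bounded through all `16 ^ B` states of a row, not just those with
  -- a given cell paired. This costs `log (16/15) ≤ 1` per row, hence `c + 1` in `hAtot`.
  have hlogN : B * Real.log 16 ≤ Real.log (15 * 16 ^ (B - 1)) + 1 := by
    obtain ⟨B', rfl⟩ := Nat.exists_eq_succ_of_ne_zero hB.ne'
    rw [Real.log_mul (by norm_num) (by positivity), Real.log_pow]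
    have h16 : Real.log 16 ≤ Real.log 15 + 1 := by
      have h2 := Real.log_le_sub_one_of_pos (show (0 : ℝ) < 16 / 15 by norm_num)
      rw [Real.log_div (by norm_num) (by norm_num)] at h2
      linarith
    simp only [Nat.succ_eq_add_one, Nat.add_sub_cancel]
    push_cast
    linarith
  have hA := sum_entropy_choice_ge hP
  have hBs := sum_entropy_state_ge hP
  have hkk : (0 : ℝ) ≤ k := Nat.cast_nonneg k
  have hlogN' := mul_le_mul_of_nonneg_left hlogN hkk
  have hAtot : ∑ j : Fin k, Z⁻¹ * ∑ z, relEntropy univ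
      (fun i => choiceWeight F j z i * pairedMass (stateWeight G j z) i) ≤ k * (c + 1) := by
    simp only [hklA, sum_sub_distrib, sum_const, card_univ, Fintype.card_fin, nsmul_eq_mul] at hA ⊢
    linarith
  have hBtot : ∑ j : Fin k, Z⁻¹ * ∑ z, ∑ i, relEntropy (pairedAt i)
      (fun β => choiceWeight F j z i * stateWeight G j z β) ≤ k * c := by
    simp only [hklB, sum_sub_distrib, sum_const, card_univ, Fintype.card_fin, nsmul_eq_mul]
      at hBs ⊢
    push_cast
    linarith
  rw [← mul_sum, inv_mul_le_iff₀ hZ0] at hAtot hBtot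
  -- The thresholds are 200 times the average deficits `c + 1` and `c`, so each deficit term
  -- contributes at most `k * Z / 200`.
  have hrow : ∀ (j : Fin k) z, _ := fun j z =>
    sum_not_isTypical_le (hcw j z) (hsw j z) (D := D) (t := 200 * (c + 1)) (l := l)
      (t' := 200 * c) (by positivity) (by positivity) hl hD hD'
  refine (sum_le_sum fun j _ => sum_le_sum fun z _ => hrow j z).trans ?_
  simp only [sum_add_distrib, ← sum_div, ← pairedTotal_eq, ← hZdef]
  simp only [sum_const, card_univ, Fintype.card_fin, nsmul_eq_mul]
  have h1 : (∑ j : Fin k, ∑ z, relEntropy univ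
      (fun i => choiceWeight F j z i * pairedMass (stateWeight G j z) i)) / (200 * (c + 1)) ≤
      k * Z / 200 := by
    rw [div_le_iff₀ (by positivity)]
    linarith
  have h2 : (∑ j : Fin k, ∑ z, ∑ i, relEntropy (pairedAt i)
      (fun β => choiceWeight F j z i * stateWeight G j z β)) / (200 * c) ≤ k * Z / 200 := by
    rw [div_le_iff₀ (by positivity)]
    linarith
  linarith

end EntropyBound

/-! ### Exchanging the chosen cell with the extra cell. -/

section Swap

open Finset

variable {B : ℕ}

/-- Resetting cell `i` forgets which of the fifteen nonzero values it had. -/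
lemma sum_pairedAt_update (i : Fin B) (ψ : (Fin B → Fin 16) → ℝ) :
    ∑ β ∈ pairedAt i, ψ (Function.update β i 0) = 15 * ∑ β ∈ singleAt i, ψ β := by
  have h : ∑ β ∈ pairedAt i, ψ (Function.update β i 0) =
      ∑ p ∈ singleAt i ×ˢ ({0}ᶜ : Finset (Fin 16)), ψ p.1 := by
    refine sum_nbij' (fun β => (Function.update β i 0, β i)) (fun p => Function.update p.1 i p.2)
      ?_ ?_ ?_ ?_ ?_
    · intro β hβ
      simpa [singleAt, pairedAt] using hβ
    · intro p hp
      simp only [mem_product, mem_compl, mem_singleton] at hp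
      simpa [pairedAt] using hp.2
    · intro β _
      simp
    · intro p hp
      simp only [singleAt, mem_product, mem_filter, mem_univ, true_and] at hp
      refine Prod.ext ?_ (by simp)
      simp only [Function.update_idem]
      rw [← hp.1, Function.update_eq_self]
    · intro β _
      rfl
  rw [h, sum_product]
  simp [card_compl, ← mul_sum]

/-- Pairing the cell `i` instead of the extra cell: if a typical cell `i` remains good after this
change, then the weight of the row does not drop much when the extra cell is paired. -/
lemma rowMass_le_of_swap {α : Fin B → ℝ} (hα : ∀ x, 0 ≤ α x) {w w₁ w' : (Fin B → Fin 16) → ℝ}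
    (hw : ∀ β, 0 ≤ w β) (hw₁ : ∀ β, 0 ≤ w₁ β) {i : Fin B} {D : ℝ}
    (h₁ : ∀ β, β i = 0 → w' β = w β) (h₂ : ∀ β, β i ≠ 0 → w' β = w₁ (Function.update β i 0))
    (hi : IsTypical D α w i) (hi' : i ∈ goodCells D w')
    (hs : 15 * singleMass w' i ≤ 200 * pairedMass w' i) :
    rowMass α w ≤ 10 ^ 4 * rowMass α w₁ := by
  obtain ⟨hspread, hgood, -, y, -, hymax, hiy⟩ := hi
  have hm : ∀ x, 0 ≤ α x * pairedMass w x := fun x => mul_nonneg (hα x) (pairedMass_nonneg hw x)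
  have hm₁ : ∀ x, 0 ≤ α x * pairedMass w₁ x :=
    fun x => mul_nonneg (hα x) (pairedMass_nonneg hw₁ x)
  have hbad := hspread (badCells w' i) (mem_filter.1 hi').2
  have hsingle : singleMass w' i = singleMass w i :=
    sum_congr rfl fun β hβ => h₁ β (mem_filter.1 hβ).2
  have hy : 15 / 256 * pairedMass w y ≤ singleMass w i := by
    refine le_trans ?_ (pairedSingleMass_le_singleMass hw y i)
    by_contra h
    exact hiy (mem_filter.2 ⟨mem_univ _, Or.inr (Or.inl (not_le.1 h))⟩)
  -- When `i` is paired in `w'`, cell `x` is paired at least half of the time, and this mass comes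
  -- from `w₁`, fifteenfold. By `hs`, `hsingle`, `hy` and the maximality of `y` it is at least `1/2
  -- * 15/200 * 15/256` times the mass of `x` in `w`.
  have hx : ∀ x, x ∈ goodCells D w → x ∉ badCells w' i →
      15 / 102400 * pairedMass w x ≤ pairedMass w₁ x := by
    intro x hxg hxb
    simp only [badCells, mem_filter, mem_univ, true_and, not_or, not_lt] at hxb
    have e : pairedPairedMass w' i x ≤ 15 * pairedMass w₁ x := by
      have e1 : pairedPairedMass w' i x = ∑ β ∈ pairedAt i,
          (fun γ : Fin B → Fin 16 => if γ x ≠ 0 then w₁ γ else 0) (Function.update β i 0) := by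
        refine sum_congr rfl fun β hβ => ?_
        simp only [Function.update_of_ne hxb.1]
        rw [h₂ β (mem_filter.1 hβ).2]
      rw [e1, sum_pairedAt_update i (fun γ : Fin B → Fin 16 => if γ x ≠ 0 then w₁ γ else 0)]
      refine mul_le_mul_of_nonneg_left ?_ (by norm_num)
      rw [← sum_filter, pairedMass]
      refine sum_le_sum_of_subset_of_nonneg (fun β hβ => ?_) fun β _ _ => hw₁ β
      simpa [pairedAt] using (mem_filter.1 hβ).2
    have := hymax x hxg
    linarith [hxb.2.2]
  -- Cells that are not good, or bad for `i`, carry at most `1/100` of the weight; `102400/15`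
  -- divided by `99/100` is below `10 ^ 4`.
  have hsum : ∑ x, α x * pairedMass w x ≤
      ∑ x ∈ (goodCells D w)ᶜ, α x * pairedMass w x + ∑ x ∈ badCells w' i, α x * pairedMass w x +
      ∑ x, 102400 / 15 * (α x * pairedMass w₁ x) := by
    have e1 : ∑ x ∈ (goodCells D w)ᶜ, α x * pairedMass w x =
        ∑ x, if x ∈ (goodCells D w)ᶜ then α x * pairedMass w x else 0 := by
      rw [sum_ite_mem, univ_inter]
    have e2 : ∑ x ∈ badCells w' i, α x * pairedMass w x =
        ∑ x, if x ∈ badCells w' i then α x * pairedMass w x else 0 := by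
      rw [sum_ite_mem, univ_inter]
    rw [e1, e2, ← sum_add_distrib, ← sum_add_distrib]
    refine sum_le_sum fun x _ => ?_
    have h0 := hm x
    have h0' := hm₁ x
    by_cases hxg : x ∈ goodCells D w
    · by_cases hxb : x ∈ badCells w' i
      · simp only [mem_compl, hxg, hxb, not_true, if_true, if_false]
        linarith
      · simp only [mem_compl, hxg, hxb, not_true, if_false]
        have := mul_le_mul_of_nonneg_left (hx x hxg hxb) (hα x)
        linarith
    · have hxg' : x ∈ (goodCells D w)ᶜ := mem_compl.2 hxg
      simp only [hxg', if_true]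
      split_ifs <;> linarith
  rw [← mul_sum] at hsum
  change rowMass α w ≤ _ + _ + 102400 / 15 * rowMass α w₁ at hsum
  have : 0 ≤ rowMass α w₁ := sum_nonneg fun x _ => hm₁ x
  linarith

/-- Both sides are compared with the heaviest good cell `y`. For a uniform state the ratio would be
15; passing through `y` and the tolerance in `badCells` each lose a factor `16/15`. -/
lemma IsTypical.pairedMass_le {α : Fin B → ℝ} {w : (Fin B → Fin 16) → ℝ} (hw : ∀ β, 0 ≤ w β)
    {i : Fin B} {D : ℝ} (hi : IsTypical D α w i) :
    pairedMass w i ≤ 256 / 15 * singleMass w i := by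
  obtain ⟨-, -, hig, y, -, hymax, hiy⟩ := hi
  have h1 := hymax i hig
  have h2 := pairedSingleMass_le_singleMass hw y i
  simp only [badCells, mem_filter, mem_univ, true_and, not_or, not_lt] at hiy
  linarith [hiy.2.1]

open Classical in
/-- A set that does not meet its image under a permutation of order five has density at most
two fifths. -/
lemma sum_ite_le_of_order_five {E : Type*} [Fintype E] (T : E ≃ E)
    (hT : ∀ e, T (T (T (T (T e)))) = e) (p : E → Prop) (hp : ∀ e, ¬ (p e ∧ p (T e)))
    (y : E → ℝ) (hy : ∀ e, 0 ≤ y e) (hyT : ∀ e, y (T e) = y e) :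
    ∑ e, (if p e then y e else 0) ≤ 2 / 5 * ∑ e, y e := by
  set h : E → ℝ := fun e => if p e then y e else 0 with hh
  have e1 : ∑ e, h (T e) = ∑ e, h e := T.sum_comp h
  have e2 : ∑ e, h (T (T e)) = ∑ e, h e := (T.sum_comp fun e => h (T e)).trans e1
  have e3 : ∑ e, h (T (T (T e))) = ∑ e, h e := (T.sum_comp fun e => h (T (T e))).trans e2
  have e4 : ∑ e, h (T (T (T (T e)))) = ∑ e, h e :=
    (T.sum_comp fun e => h (T (T (T e)))).trans e3
  -- Among five cyclically arranged points with no two neighbours in `p`, at most two satisfy `p`.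
  -- Odd length matters: an even cycle would only give density `1/2`.
  have key : ∑ e, (h e + h (T e) + h (T (T e)) + h (T (T (T e))) + h (T (T (T (T e))))) ≤
      ∑ e, 2 * y e := by
    refine sum_le_sum fun e _ => ?_
    simp only [hh, hyT]
    have p0 := hp e
    have p1 := hp (T e)
    have p2 := hp (T (T e))
    have p3 := hp (T (T (T e)))
    have p4 := hp (T (T (T (T e))))
    rw [hT] at p4
    have := hy e
    by_cases q0 : p e <;> by_cases q1 : p (T e) <;> by_cases q2 : p (T (T e)) <;>
      by_cases q3 : p (T (T (T e))) <;> by_cases q4 : p (T (T (T (T e)))) <;>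
      simp only [q0, q1, q2, q3, q4, if_true, if_false, and_true, and_false, 
        not_true, not_false_iff] at * <;> linarith
  simp only [sum_add_distrib, e1, e2, e3, e4, ← mul_sum] at key
  linarith

end Swap

/-! ### Random placements and their rotation of order five. -/

section Placement

open Finset

/-- The positions: one extra vertex, and two vertices for the extra cell and for each of the `B`
cells in each of the `k` rows. -/
abbrev Position (k B : ℕ) : Type := Option (Option (Fin k × Fin B) × Bool)

variable {k B : ℕ}

/-- The positions in the extra vertex, the extra cell and the chosen cells. -/
def chosenPositions (a : Fin k → Fin B) : Finset (Position k B) :=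
  univ.filter fun p => ∀ q ∈ p, ∀ c ∈ q.1, a c.1 = c.2

/-- The cells that are paired; `t` tells whether the extra cell is. -/
def pairedCells (t : Bool) (b : Fin k → Fin B → Fin 16) : Finset (Option (Fin k × Fin B)) :=
  univ.filter fun c => (c = none → t = true) ∧ ∀ d ∈ c, b d.1 d.2 ≠ 0

lemma none_mem_pairedCells {t : Bool} {b : Fin k → Fin B → Fin 16} :
    none ∈ pairedCells t b ↔ t = true := by simp [pairedCells]

lemma some_mem_pairedCells {t : Bool} {b : Fin k → Fin B → Fin 16} {d : Fin k × Fin B} :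
    some d ∈ pairedCells t b ↔ b d.1 d.2 ≠ 0 := by
  simp only [pairedCells, mem_filter, mem_univ, true_and, reduceCtorEq, false_imp_iff,
    Option.mem_def, Option.some.injEq, forall_eq']

/-- The rotation of the positions of the extra vertex, the extra cell and the cell `c`. -/
def rotateFun (c : Fin k × Fin B) : Position k B → Position k B
  -- A single 5-cycle in which both vertices of `c` go to the extra cell, so a rotated placement
  -- sees the old extra edge in cell `c`. The new extra cell is not an old cell, which is harmless
  -- as it stays unpaired.
  | none => some (some c, true)
  | some (none, false) => none
  | some (none, true) => some (some c, false)
  | some (some d, t) => if d = c then some (none, t) else some (some d, t)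

lemma rotateFun_five (c : Fin k × Fin B) (p : Position k B) :
    rotateFun c (rotateFun c (rotateFun c (rotateFun c (rotateFun c p)))) = p := by
  rcases p with _ | ⟨_ | d, _ | _⟩
  · simp [rotateFun]
  · simp [rotateFun]
  · simp [rotateFun]
  · by_cases h : d = c <;> simp [rotateFun, h]
  · by_cases h : d = c <;> simp [rotateFun, h]

/-- The rotation of the positions of the extra vertex, the extra cell and the cell `c`. -/
def rotate (c : Fin k × Fin B) : Equiv.Perm (Position k B) where
  toFun := rotateFun c
  invFun p := rotateFun c (rotateFun c (rotateFun c (rotateFun c p)))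
  left_inv := rotateFun_five c
  right_inv := rotateFun_five c

variable {V : Type*} [DecidableEq V]

/-- The vertices in the chosen positions. -/
def chosenVertices (σ : Position k B ↪ V) (a : Fin k → Fin B) : Finset V :=
  (chosenPositions a).map σ

/-- The edge joining the two vertices of a cell. -/
def cellEdge (σ : Position k B ↪ V) (c : Option (Fin k × Fin B)) : Sym2 V :=
  s(σ (some (c, false)), σ (some (c, true)))

/-- The edges in the cells of `S`. -/
def cellEdges (σ : Position k B ↪ V) (S : Finset (Option (Fin k × Fin B))) : Finset (Sym2 V) :=
  S.image (cellEdge σ)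

/-- The effect of the rotation on placements. -/
def rotatePlacement (V : Type*) (c : Fin k × Fin B) :
    (Position k B ↪ V) ≃ (Position k B ↪ V) where
  toFun σ := (rotate c).toEmbedding.trans σ
  invFun σ := (rotate c).symm.toEmbedding.trans σ
  left_inv σ := by ext p; simp
  right_inv σ := by ext p; simp

lemma rotatePlacement_apply (c : Fin k × Fin B) (σ : Position k B ↪ V) (p : Position k B) :
    rotatePlacement V c σ p = σ (rotateFun c p) := rfl

lemma rotatePlacement_five (c : Fin k × Fin B) (σ : Position k B ↪ V) :
    rotatePlacement V c (rotatePlacement V c (rotatePlacement V c (rotatePlacement V c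
      (rotatePlacement V c σ)))) = σ := by
  ext p
  simp only [rotatePlacement_apply, rotateFun_five]

lemma rotateFun_mem_chosenPositions (c : Fin k × Fin B) (a : Fin k → Fin B) (h : a c.1 = c.2)
    (p : Position k B) : rotateFun c p ∈ chosenPositions a ↔ p ∈ chosenPositions a := by
  have h' : ∀ j i, c = (j, i) → a j = i := by
    rintro j i rfl
    exact h
  rcases p with _ | ⟨_ | d, _ | _⟩
  · simpa [rotateFun, chosenPositions] using h'
  · simp [rotateFun, chosenPositions]
  · simpa [rotateFun, chosenPositions] using h'
  · by_cases hd : d = c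
    · subst hd; simpa [rotateFun, chosenPositions] using h'
    · simp [rotateFun, chosenPositions, hd]
  · by_cases hd : d = c
    · subst hd; simpa [rotateFun, chosenPositions] using h'
    · simp [rotateFun, chosenPositions, hd]

lemma chosenVertices_rotatePlacement (c : Fin k × Fin B) (a : Fin k → Fin B) (h : a c.1 = c.2)
    (σ : Position k B ↪ V) :
    chosenVertices (rotatePlacement V c σ) a = chosenVertices σ a := by
  ext v
  simp only [chosenVertices, mem_map, rotatePlacement_apply]
  constructor
  · rintro ⟨p, hp, rfl⟩
    exact ⟨_, (rotateFun_mem_chosenPositions c a h p).2 hp, rfl⟩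
  · rintro ⟨p, hp, rfl⟩
    obtain ⟨q, rfl⟩ := (rotate c).surjective p
    exact ⟨q, (rotateFun_mem_chosenPositions c a h q).1 hp, rfl⟩

lemma cellEdge_rotatePlacement_of_ne (c d : Fin k × Fin B) (h : d ≠ c) (σ : Position k B ↪ V) :
    cellEdge (rotatePlacement V c σ) (some d) = cellEdge σ (some d) := by
  simp [cellEdge, rotatePlacement_apply, rotateFun, h]

lemma cellEdge_rotatePlacement_self (c : Fin k × Fin B) (σ : Position k B ↪ V) :
    cellEdge (rotatePlacement V c σ) (some c) = cellEdge σ none := by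
  simp [cellEdge, rotatePlacement_apply, rotateFun]

lemma cellEdges_rotatePlacement_of_single (c : Fin k × Fin B) (b : Fin k → Fin B → Fin 16)
    (hb : b c.1 c.2 = 0) (σ : Position k B ↪ V) :
    cellEdges (rotatePlacement V c σ) (pairedCells false b) =
      cellEdges σ (pairedCells false b) := by
  refine image_congr fun x hx => ?_
  rcases x with _ | d
  · simp [none_mem_pairedCells] at hx
  · refine cellEdge_rotatePlacement_of_ne c d ?_ σ
    rintro rfl
    exact some_mem_pairedCells.1 hx hb

lemma cellEdges_rotatePlacement_of_paired (c : Fin k × Fin B) (b b' : Fin k → Fin B → Fin 16)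
    (hb : b c.1 c.2 ≠ 0) (hb' : b' c.1 c.2 = 0)
    (hbb' : ∀ d : Fin k × Fin B, d ≠ c → b' d.1 d.2 = b d.1 d.2) (σ : Position k B ↪ V) :
    cellEdges (rotatePlacement V c σ) (pairedCells false b) =
      cellEdges σ (pairedCells true b') := by
  ext e
  simp only [cellEdges, mem_image]
  constructor
  · rintro ⟨x, hx, rfl⟩
    rcases x with _ | d
    · simp [none_mem_pairedCells] at hx
    · by_cases hd : d = c
      · subst hd
        exact ⟨none, none_mem_pairedCells.2 rfl, (cellEdge_rotatePlacement_self d σ).symm⟩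
      · refine ⟨some d, ?_, (cellEdge_rotatePlacement_of_ne c d hd σ).symm⟩
        rwa [some_mem_pairedCells, hbb' d hd, ← some_mem_pairedCells (t := false)]
  · rintro ⟨x, hx, rfl⟩
    rcases x with _ | d
    · exact ⟨some c, some_mem_pairedCells.2 hb, cellEdge_rotatePlacement_self c σ⟩
    · have hd : d ≠ c := by
        rintro rfl
        exact some_mem_pairedCells.1 hx hb'
      refine ⟨some d, ?_, cellEdge_rotatePlacement_of_ne c d hd σ⟩
      rwa [some_mem_pairedCells, ← hbb' d hd, ← some_mem_pairedCells (t := true)]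

/-- The weight of the choices under a placement. -/
def placedChoice (f : Finset V → ℝ) (σ : Position k B ↪ V) (a : Fin k → Fin B) : ℝ :=
  f (chosenVertices σ a)

/-- The weight of the states under a placement. -/
def placedState (g : Finset (Sym2 V) → ℝ) (t : Bool) (σ : Position k B ↪ V)
    (b : Fin k → Fin B → Fin 16) : ℝ :=
  g (cellEdges σ (pairedCells t b))

variable {f : Finset V → ℝ} {g : Finset (Sym2 V) → ℝ}

/-- All five rotated vertices belong to the set `U` whenever `i` is chosen in row `j`, so `U` does
not change. -/
lemma choiceWeight_rotatePlacement (j : Fin k) (i : Fin B) (z : Context k B j)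
    (σ : Position k B ↪ V) :
    choiceWeight (placedChoice f (rotatePlacement V (j, i) σ)) j z i =
      choiceWeight (placedChoice f σ) j z i := by
  refine sum_congr rfl fun r _ => ?_
  rw [placedChoice, chosenVertices_rotatePlacement (j, i) _ (glue_self _ _ _), placedChoice]

lemma stateWeight_rotatePlacement_of_single (j : Fin k) (i : Fin B) (z : Context k B j)
    (σ : Position k B ↪ V) (β : Fin B → Fin 16) (hβ : β i = 0) :
    stateWeight (placedState g false (rotatePlacement V (j, i) σ)) j z β =
      stateWeight (placedState g false σ) j z β := by
  refine sum_congr rfl fun r _ => ?_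
  rw [placedState, cellEdges_rotatePlacement_of_single, placedState]
  simpa [glue_self] using hβ

lemma glue_apply_of_ne {X : Type*} {j : Fin k} (l : {x // x < j} → X) (y y' : X)
    (r : {x // j < x} → X) {x : Fin k} (h : x ≠ j) : glue j l y r x = glue j l y' r x := by
  rcases lt_or_gt_of_ne h with h | h
  · rw [glue_lt _ _ _ h, glue_lt _ _ _ h]
  · rw [glue_gt _ _ _ h, glue_gt _ _ _ h]

/-- The edge that cell `i` has after the rotation is the extra edge before it. This and the
preceding single case are the two hypotheses on `w'` in `rowMass_le_of_swap`. -/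
lemma stateWeight_rotatePlacement_of_paired (j : Fin k) (i : Fin B) (z : Context k B j)
    (σ : Position k B ↪ V) (β : Fin B → Fin 16) (hβ : β i ≠ 0) :
    stateWeight (placedState g false (rotatePlacement V (j, i) σ)) j z β =
      stateWeight (placedState g true σ) j z (Function.update β i 0) := by
  refine sum_congr rfl fun r _ => ?_
  rw [placedState, cellEdges_rotatePlacement_of_paired (j, i) _
    (glue j r (Function.update β i 0) z.2), placedState]
  · simpa [glue_self] using hβ
  · simp [glue_self]
  · rintro ⟨j', i'⟩ hd
    by_cases hj : j' = j
    · subst hj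
      have : i' ≠ i := fun h => hd (by rw [h])
      simp [glue_self, this]
    · exact congrFun (glue_apply_of_ne _ _ _ _ hj) i'

end Placement

/-! ### The inequality for one product of weights. -/

section Core

open Finset

variable {k B : ℕ} {V : Type*} [DecidableEq V] [Fintype V]

/-- The central inequality on a product of weights on vertex sets and on matchings. -/
theorem placed_pairedTotal_le {f : Finset V → ℝ} {g : Finset (Sym2 V) → ℝ} (hB : 0 < B)
    (hf : ∀ U, 0 ≤ f U) (hf1 : ∀ U, f U ≤ 1) (hg : ∀ M, 0 ≤ g M) (hg1 : ∀ M, g M ≤ 1)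
    {D l c : ℝ} (hc : 0 < c)
    (hl : 200 * (200 * (c + 1) + 1) ≤ l) (hD : D * Real.exp l ≤ B)
    (hD' : 1 + 8195 * (200 * (200 * c)) ≤ D) :
    49 / 50 * (k * ∑ σ : Position k B ↪ V, pairedTotal (placedChoice f σ) (placedState g false σ)) ≤
      k * (Fintype.card (Position k B ↪ V) *
        (Real.exp (-(k * c)) * (B * (15 * 16 ^ (B - 1))) ^ k)) +
      10 ^ 4 * (k * ∑ σ : Position k B ↪ V,
        pairedTotal (placedChoice f σ) (placedState g true σ)) +
      (15 / 200 + 2 / 5 * (256 / 15)) * ∑ j : Fin k, ∑ σ : Position k B ↪ V,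
        singleTotal (placedChoice f σ) (placedState g false σ) j := by
  classical
  set F := fun σ : Position k B ↪ V => placedChoice (k := k) (B := B) f σ with hF
  set G := fun σ : Position k B ↪ V => placedState (k := k) (B := B) g false σ with hG
  set G₁ := fun σ : Position k B ↪ V => placedState (k := k) (B := B) g true σ with hG₁
  have hF0 : ∀ σ a, 0 ≤ F σ a := fun σ a => hf _
  have hF1 : ∀ σ a, F σ a ≤ 1 := fun σ a => hf1 _
  have hG0 : ∀ σ b, 0 ≤ G σ b := fun σ b => hg _
  have hG1 : ∀ σ b, G σ b ≤ 1 := fun σ b => hg1 _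
  have hG₁0 : ∀ σ b, 0 ≤ G₁ σ b := fun σ b => hg _
  have hα := fun σ j => choiceWeight_nonneg (hF0 σ) j
  have hw := fun σ j => stateWeight_nonneg (hG0 σ) j
  have hw₁ := fun σ j => stateWeight_nonneg (hG₁0 σ) j
  set E : ℝ := Real.exp (-(k * c)) * (B * (15 * 16 ^ (B - 1))) ^ k with hE
  have hE0 : 0 ≤ E := by positivity
  -- The placements in which the rotation argument is needed: `i` is typical, yet pairing the extra
  -- cell leaves hardly any weight.
  obtain ⟨bad, hbad⟩ : ∃ bad : (j : Fin k) → Context k B j → Fin B → (Position k B ↪ V) → Prop,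
      ∀ j z i σ, bad j z i σ ↔
    IsTypical D (choiceWeight (F σ) j z) (stateWeight (G σ) j z) i ∧
    15 * singleMass (stateWeight (G σ) j z) i ≤ 200 * pairedMass (stateWeight (G σ) j z) i ∧
    10 ^ 4 * rowMass (choiceWeight (F σ) j z) (stateWeight (G₁ σ) j z) <
      rowMass (choiceWeight (F σ) j z) (stateWeight (G σ) j z) :=
    ⟨_, fun _ _ _ _ => Iff.rfl⟩
  -- The context and `i` are fixed, and the weight with `i` single is invariant under the rotation
  -- about `i`. Two consecutive bad placements contradict `rowMass_le_of_swap`.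
  have hbad2 : ∀ j z i, ∑ σ, (if bad j z i σ then
      choiceWeight (F σ) j z i * singleMass (stateWeight (G σ) j z) i else 0) ≤
      2 / 5 * ∑ σ, choiceWeight (F σ) j z i * singleMass (stateWeight (G σ) j z) i := by
    intro j z i
    refine sum_ite_le_of_order_five (rotatePlacement V (j, i)) (rotatePlacement_five (j, i))
      (bad j z i) ?_ _ ?_ ?_
    · rintro σ ⟨hσ, hσ'⟩
      obtain ⟨h1, -, h2⟩ := (hbad j z i σ).1 hσ
      obtain ⟨h3, h4, -⟩ := (hbad j z i _).1 hσ'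
      refine absurd h2 (not_lt.2 ?_)
      exact rowMass_le_of_swap (hα σ j z) (hw σ j z) (hw₁ σ j z)
        (stateWeight_rotatePlacement_of_single j i z σ)
        (stateWeight_rotatePlacement_of_paired j i z σ) h1 h3.2.2.1 h4
    · exact fun σ => mul_nonneg (hα σ j z i) (sum_nonneg fun β _ => hw σ j z β)
    · intro σ
      rw [hF, hG]
      dsimp only
      rw [choiceWeight_rotatePlacement]
      congr 1
      exact sum_congr rfl fun β hβ =>
        stateWeight_rotatePlacement_of_single j i z σ β (mem_filter.1 hβ).2
  have hatyp : ∀ σ, ∑ j : Fin k, ∑ z, ∑ i,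
      (if IsTypical D (choiceWeight (F σ) j z) (stateWeight (G σ) j z) i then 0
        else choiceWeight (F σ) j z i * pairedMass (stateWeight (G σ) j z) i) ≤
      k * pairedTotal (F σ) (G σ) / 50 + k * E := by
    intro σ
    have hkE : 0 ≤ k * E := by positivity
    -- Below the threshold `E` the entropy argument gives nothing, but the whole weight is then
    -- absorbed by the error term.
    by_cases hZ : E ≤ pairedTotal (F σ) (G σ)
    · have := sum_sum_not_isTypical_le hB (hF0 σ) (hF1 σ) (hG0 σ) (hG1 σ) hc hl hD hD' hZ
      linarith
    · have h1 : ∑ j : Fin k, ∑ z, ∑ i,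
          (if IsTypical D (choiceWeight (F σ) j z) (stateWeight (G σ) j z) i then 0
            else choiceWeight (F σ) j z i * pairedMass (stateWeight (G σ) j z) i) ≤
          ∑ j : Fin k, pairedTotal (F σ) (G σ) := by
        refine sum_le_sum fun j _ => ?_
        rw [pairedTotal_eq _ _ j]
        refine sum_le_sum fun z _ => sum_le_sum fun i _ => ?_
        have := mul_nonneg (hα σ j z i) (pairedMass_nonneg (hw σ j z) i)
        split_ifs <;> linarith
      simp only [sum_const, card_univ, Fintype.card_fin, nsmul_eq_mul] at h1
      have h2 : (k : ℝ) * pairedTotal (F σ) (G σ) ≤ k * E :=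
        mul_le_mul_of_nonneg_left (not_le.1 hZ).le (Nat.cast_nonneg k)
      have h3 : 0 ≤ pairedTotal (F σ) (G σ) :=
        sum_nonneg fun a _ => sum_nonneg fun b _ => by
          split_ifs
          · exact mul_nonneg (hF0 σ a) (hG0 σ b)
          · exact le_rfl
      have h4 : 0 ≤ (k : ℝ) * pairedTotal (F σ) (G σ) / 50 := by positivity
      linarith
  -- A cell is atypical, or far more often single than paired (the term `15/200`), or bad, or else
  -- the row is bounded by its weight with the extra cell paired.
  have hrow : ∀ σ j z, rowMass (choiceWeight (F σ) j z) (stateWeight (G σ) j z) ≤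
      10 ^ 4 * rowMass (choiceWeight (F σ) j z) (stateWeight (G₁ σ) j z) +
      ∑ i, (if IsTypical D (choiceWeight (F σ) j z) (stateWeight (G σ) j z) i then 0
        else choiceWeight (F σ) j z i * pairedMass (stateWeight (G σ) j z) i) +
      15 / 200 * ∑ i, choiceWeight (F σ) j z i * singleMass (stateWeight (G σ) j z) i +
      256 / 15 * ∑ i, (if bad j z i σ then
        choiceWeight (F σ) j z i * singleMass (stateWeight (G σ) j z) i else 0) := by
    intro σ j z
    have hp : ∀ i, 0 ≤ choiceWeight (F σ) j z i * pairedMass (stateWeight (G σ) j z) i :=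
      fun i => mul_nonneg (hα σ j z i) (pairedMass_nonneg (hw σ j z) i)
    have hp₁ : ∀ i, 0 ≤ choiceWeight (F σ) j z i * pairedMass (stateWeight (G₁ σ) j z) i :=
      fun i => mul_nonneg (hα σ j z i) (pairedMass_nonneg (hw₁ σ j z) i)
    have hs : ∀ i, 0 ≤ choiceWeight (F σ) j z i * singleMass (stateWeight (G σ) j z) i :=
      fun i => mul_nonneg (hα σ j z i) (sum_nonneg fun β _ => hw σ j z β)
    have hr₁ : 0 ≤ rowMass (choiceWeight (F σ) j z) (stateWeight (G₁ σ) j z) :=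
      sum_nonneg fun i _ => hp₁ i
    by_cases h : 10 ^ 4 * rowMass (choiceWeight (F σ) j z) (stateWeight (G₁ σ) j z) <
      rowMass (choiceWeight (F σ) j z) (stateWeight (G σ) j z)
    · have key : rowMass (choiceWeight (F σ) j z) (stateWeight (G σ) j z) ≤
          ∑ i, (if IsTypical D (choiceWeight (F σ) j z) (stateWeight (G σ) j z) i then 0
            else choiceWeight (F σ) j z i * pairedMass (stateWeight (G σ) j z) i) +
          15 / 200 * ∑ i, choiceWeight (F σ) j z i * singleMass (stateWeight (G σ) j z) i +
          256 / 15 * ∑ i, (if bad j z i σ then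
            choiceWeight (F σ) j z i * singleMass (stateWeight (G σ) j z) i else 0) := by
        rw [mul_sum, mul_sum, ← sum_add_distrib, ← sum_add_distrib]
        refine sum_le_sum fun i _ => ?_
        have hsi := hs i
        have hpi := hp i
        by_cases ht : IsTypical D (choiceWeight (F σ) j z) (stateWeight (G σ) j z) i
        · by_cases h2 : 15 * singleMass (stateWeight (G σ) j z) i ≤
            200 * pairedMass (stateWeight (G σ) j z) i
          · have hb : bad j z i σ := (hbad j z i σ).2 ⟨ht, h2, h⟩
            rw [if_pos ht, if_pos hb]
            have := mul_le_mul_of_nonneg_left (ht.pairedMass_le (hw σ j z)) (hα σ j z i)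
            linarith
          · rw [if_pos ht]
            have := mul_le_mul_of_nonneg_left (not_le.1 h2).le (hα σ j z i)
            have h0 : 0 ≤ 256 / 15 * (if bad j z i σ then
              choiceWeight (F σ) j z i * singleMass (stateWeight (G σ) j z) i else 0) := by
              split_ifs <;> linarith
            linarith
        · rw [if_neg ht]
          have h0 : 0 ≤ 256 / 15 * (if bad j z i σ then
            choiceWeight (F σ) j z i * singleMass (stateWeight (G σ) j z) i else 0) := by
            split_ifs <;> linarith
          linarith
      linarith
    · have h1 : 0 ≤ ∑ i, (if IsTypical D (choiceWeight (F σ) j z) (stateWeight (G σ) j z) i then 0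
          else choiceWeight (F σ) j z i * pairedMass (stateWeight (G σ) j z) i) :=
        sum_nonneg fun i _ => by split_ifs <;> simp [hp i]
      have h2 : 0 ≤ ∑ i, choiceWeight (F σ) j z i * singleMass (stateWeight (G σ) j z) i :=
        sum_nonneg fun i _ => hs i
      have h3 : 0 ≤ ∑ i, (if bad j z i σ then
          choiceWeight (F σ) j z i * singleMass (stateWeight (G σ) j z) i else 0) :=
        sum_nonneg fun i _ => by split_ifs <;> simp [hs i]
      linarith
  have hsum := sum_le_sum fun σ (_ : σ ∈ univ) => sum_le_sum fun (j : Fin k) (_ : j ∈ univ) =>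
    sum_le_sum fun z (_ : z ∈ univ) => hrow σ j z
  simp only [sum_add_distrib, ← mul_sum, ← pairedTotal_eq, ← singleTotal_eq] at hsum
  simp only [sum_const, card_univ, Fintype.card_fin, nsmul_eq_mul] at hsum
  have hat := sum_le_sum fun σ (_ : σ ∈ univ) => hatyp σ
  simp only [sum_add_distrib, ← sum_div, ← mul_sum, sum_const, card_univ, nsmul_eq_mul] at hat
  have hb : ∑ σ, ∑ j : Fin k, ∑ z, ∑ i, (if bad j z i σ then
      choiceWeight (F σ) j z i * singleMass (stateWeight (G σ) j z) i else 0) ≤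
      2 / 5 * ∑ j : Fin k, ∑ σ, singleTotal (F σ) (G σ) j := by
    rw [sum_comm, mul_sum]
    refine sum_le_sum fun j _ => ?_
    rw [sum_comm]
    simp only [singleTotal_eq]
    rw [sum_comm (s := (univ : Finset (Position k B ↪ V))), mul_sum]
    refine sum_le_sum fun z _ => ?_
    rw [sum_comm, sum_comm (s := (univ : Finset (Position k B ↪ V))), mul_sum]
    exact sum_le_sum fun i _ => hbad2 j z i
  have hcomm : ∑ σ, ∑ j : Fin k, singleTotal (F σ) (G σ) j =
    ∑ j : Fin k, ∑ σ, singleTotal (F σ) (G σ) j := sum_comm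
  rw [hcomm] at hsum
  simp only [← mul_sum] at hsum
  change 49 / 50 * (k * ∑ σ, pairedTotal (F σ) (G σ)) ≤
    k * (Fintype.card (Position k B ↪ V) * E) + 10 ^ 4 * (k * ∑ σ, pairedTotal (F σ) (G₁ σ)) +
      (15 / 200 + 2 / 5 * (256 / 15)) * ∑ j : Fin k, ∑ σ, singleTotal (F σ) (G σ) j
  linarith

end Core

/-! ### Facets generate the nonnegative affine functionals; Yannakakis' factorization. -/

section Polytope

open Finset

variable {d : ℕ}

/-- The values at the points of `s` of an affine functional. -/
def affineValues (s : Finset (Fin d → ℝ)) :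
    ((Fin d → ℝ) →ₗ[ℝ] ℝ) × ℝ →ₗ[ℝ] (s → ℝ) where
  toFun p v := p.2 + p.1 v
  map_add' p q := by ext v; simp; ring
  map_smul' a p := by ext v; simp; ring

lemma affineValues_apply (s : Finset (Fin d → ℝ)) (p : ((Fin d → ℝ) →ₗ[ℝ] ℝ) × ℝ) (v : s) :
    affineValues s p v = p.2 + p.1 v := rfl

/-- A base of the cone of the affine functionals that are nonnegative on `s`. -/
def affineBase (s : Finset (Fin d → ℝ)) : Set (s → ℝ) :=
  {w | w ∈ LinearMap.range (affineValues s) ∧ (∀ v, 0 ≤ w v) ∧ ∑ v, w v = 1}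

lemma convex_affineBase (s : Finset (Fin d → ℝ)) : Convex ℝ (affineBase s) := by
  rintro w ⟨hw, hw0, hw1⟩ u ⟨hu, hu0, hu1⟩ a b ha hb hab
  refine ⟨Submodule.add_mem _ (Submodule.smul_mem _ _ hw) (Submodule.smul_mem _ _ hu),
    fun v => ?_, ?_⟩
  · exact add_nonneg (mul_nonneg ha (hw0 v)) (mul_nonneg hb (hu0 v))
  · simp only [Pi.add_apply, Pi.smul_apply, smul_eq_mul, sum_add_distrib, ← mul_sum, hw1, hu1]
    linarith

lemma isCompact_affineBase (s : Finset (Fin d → ℝ)) : IsCompact (affineBase s) := by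
  have h : affineBase s = (LinearMap.range (affineValues s) : Set (s → ℝ)) ∩ stdSimplex ℝ s := by
    ext w
    rfl
  rw [h]
  exact (isCompact_stdSimplex ℝ s).inter_left (Submodule.closed_of_finiteDimensional _)

/-- The difference `x` vanishes wherever `w` does, so `w ± t • x` stays in the base for small `t >
0`; extremality forces `x = 0`. -/
lemma eq_smul_of_mem_extremePoints {s : Finset (Fin d → ℝ)} {w u : s → ℝ}
    (hw : w ∈ (affineBase s).extremePoints ℝ) (hu : u ∈ LinearMap.range (affineValues s))
    (h : ∀ v, w v = 0 → u v = 0) : u = (∑ v, u v) • w := by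
  obtain ⟨⟨hwr, hw0, hw1⟩, hext⟩ := hw
  set x : s → ℝ := u - (∑ v, u v) • w with hx
  have hxr : x ∈ LinearMap.range (affineValues s) :=
    Submodule.sub_mem _ hu (Submodule.smul_mem _ _ hwr)
  have hx0 : ∀ v, w v = 0 → x v = 0 := fun v hv => by simp [hx, hv, h v hv]
  have hx1 : ∑ v, x v = 0 := by
    simp only [hx, Pi.sub_apply, Pi.smul_apply, smul_eq_mul, sum_sub_distrib, ← mul_sum, hw1]
    ring
  have hev : ∀ᶠ t : ℝ in nhdsWithin 0 (Set.Ioi 0), ∀ v, t * |x v| ≤ w v := by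
    rw [Filter.eventually_all]
    intro v
    by_cases hv : w v = 0
    · simp [hx0 v hv, hv]
    · have hpos : 0 < w v := lt_of_le_of_ne (hw0 v) (Ne.symm hv)
      have hc : Filter.Tendsto (fun t : ℝ => t * |x v|) (nhds 0) (nhds (0 * |x v|)) :=
        (continuous_id.mul continuous_const).tendsto 0
      rw [zero_mul] at hc
      exact ((hc.eventually (gt_mem_nhds hpos)).filter_mono nhdsWithin_le_nhds).mono
        fun t ht => ht.le
  obtain ⟨t, ht, ht0⟩ := (hev.and self_mem_nhdsWithin).exists
  have ht0' : (0 : ℝ) < t := ht0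
  have hmem : ∀ r : ℝ, |r| ≤ t → w + r • x ∈ affineBase s := by
    intro r hr
    refine ⟨Submodule.add_mem _ hwr (Submodule.smul_mem _ _ hxr), fun v => ?_, ?_⟩
    · have h1 : |r * x v| ≤ t * |x v| := by
        rw [abs_mul]
        exact mul_le_mul_of_nonneg_right hr (abs_nonneg _)
      have h2 := neg_abs_le (r * x v)
      have h3 := ht v
      simp only [Pi.add_apply, Pi.smul_apply, smul_eq_mul]
      linarith
    · simp only [Pi.add_apply, Pi.smul_apply, smul_eq_mul, sum_add_distrib, ← mul_sum, hw1, hx1]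
      ring
  have h1 := hmem t (by rw [abs_of_pos ht0'])
  have h2 := hmem (-t) (by rw [abs_neg, abs_of_pos ht0'])
  have heq := hext h1 h2 ⟨1 / 2, 1 / 2, by norm_num, by norm_num, by norm_num, by
    ext v
    simp
    ring⟩
  have hxz : x = 0 := by
    have : t • x = 0 := by simpa using heq
    exact (smul_eq_zero.1 this).resolve_left ht0'.ne'
  exact sub_eq_zero.1 hxz

lemma eq_of_mem_extremePoints {s : Finset (Fin d → ℝ)} {w u : s → ℝ}
    (hw : w ∈ (affineBase s).extremePoints ℝ) (hu : u ∈ affineBase s)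
    (h : ∀ v, w v = 0 → u v = 0) : u = w := by
  have := eq_smul_of_mem_extremePoints hw hu.1 h
  rwa [hu.2.2, one_smul] at this

/-- An extreme point is determined by its zero set, a subset of the finite set `s`. -/
lemma finite_extremePoints_affineBase (s : Finset (Fin d → ℝ)) :
    ((affineBase s).extremePoints ℝ).Finite := by
  refine Set.Finite.of_finite_image (f := fun w => {v | w v = 0}) (Set.toFinite _) ?_
  intro w hw u hu h
  refine (eq_of_mem_extremePoints hw hu.1 fun v hv => ?_).symm
  have : v ∈ {v | w v = 0} := hv
  change {v | w v = 0} = {v | u v = 0} at h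
  rw [h] at this
  exact this

lemma convexHull_extremePoints_affineBase (s : Finset (Fin d → ℝ)) :
    convexHull ℝ ((affineBase s).extremePoints ℝ) = affineBase s := by
  rw [← (finite_extremePoints_affineBase s).isClosed_convexHull ℝ |>.closure_eq]
  exact closure_convexHull_extremePoints (isCompact_affineBase s) (convex_affineBase s)

lemma nonneg_on_convexHull {s : Set (Fin d → ℝ)} {l : (Fin d → ℝ) →ₗ[ℝ] ℝ} {c : ℝ}
    (h : ∀ v ∈ s, 0 ≤ c + l v) : ∀ y ∈ convexHull ℝ s, 0 ≤ c + l y := by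
  intro y hy
  have h1 : convexHull ℝ s ⊆ {y | -c ≤ l y} :=
    convexHull_min (fun v hv => by have := h v hv; simp only [Set.mem_ofPred_eq]; linarith)
      (convex_halfSpace_ge l.isLinear _)
  have := h1 hy
  simp only [Set.mem_ofPred_eq] at this
  linarith

lemma vectorSpan_convexHull (s : Set (Fin d → ℝ)) :
    vectorSpan ℝ (convexHull ℝ s) = vectorSpan ℝ s := by
  rw [← direction_affineSpan, ← direction_affineSpan, affineSpan_convexHull]

/-- An extreme nonnegative affine functional that vanishes somewhere defines a facet. -/
lemma isFacet_of_mem_extremePoints {s : Finset (Fin d → ℝ)} {l : (Fin d → ℝ) →ₗ[ℝ] ℝ} {c : ℝ}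
    (hw : affineValues s (l, c) ∈ (affineBase s).extremePoints ℝ) {v₀ : Fin d → ℝ} (hv₀ : v₀ ∈ s)
    (h₀ : c + l v₀ = 0) :
    IsFacet (convexHull ℝ (s : Set (Fin d → ℝ)))
      {y | y ∈ convexHull ℝ (s : Set (Fin d → ℝ)) ∧ c + l y = 0} := by
  set Q := convexHull ℝ (s : Set (Fin d → ℝ)) with hQ
  set F := {y | y ∈ Q ∧ c + l y = 0} with hF
  have hsQ : ∀ v ∈ s, v ∈ Q := fun v hv => subset_convexHull ℝ _ hv
  have hnn : ∀ y ∈ Q, 0 ≤ c + l y := nonneg_on_convexHull fun v hv => hw.1.2.1 ⟨v, hv⟩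
  have hv₀F : v₀ ∈ F := ⟨hsQ v₀ hv₀, h₀⟩
  refine ⟨⟨v₀, hv₀F⟩, fun _ => ⟨LinearMap.toContinuousLinearMap (-l), ?_⟩, ?_⟩
  · ext y
    simp only [hF, Set.mem_ofPred_eq, LinearMap.coe_toContinuousLinearMap', LinearMap.neg_apply,
      neg_le_neg_iff]
    refine and_congr_right fun hy => ⟨fun h y' hy' => ?_, fun h => ?_⟩
    · have := hnn y' hy'
      linarith
    · have h1 := h v₀ (hsQ v₀ hv₀)
      have h2 := hnn y hy
      linarith
  · have hD : vectorSpan ℝ Q = Submodule.span ℝ ((fun v => v - v₀) '' (s : Set (Fin d → ℝ))) := by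
      rw [hQ, vectorSpan_convexHull, vectorSpan_eq_span_vsub_set_right ℝ hv₀]
      rfl
    have hFD : vectorSpan ℝ F = vectorSpan ℝ Q ⊓ LinearMap.ker l := by
      apply le_antisymm
      · refine le_inf (vectorSpan_mono ℝ fun y hy => hy.1) ?_
        rw [vectorSpan_eq_span_vsub_set_right ℝ hv₀F, Submodule.span_le]
        rintro _ ⟨y, hy, rfl⟩
        have := hy.2
        simp only [vsub_eq_sub, SetLike.mem_coe, LinearMap.mem_ker, map_sub]
        linarith
      · rintro x ⟨hxD, hxl⟩
        by_contra hx
        obtain ⟨g, hgx, hg⟩ := Submodule.exists_le_ker_of_notMem hx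
        have hgs : ∀ v : s, affineValues s (l, c) v = 0 → affineValues s (g, -g v₀) v = 0 := by
          intro v hv
          have hvF : (v : Fin d → ℝ) ∈ F := ⟨hsQ v v.2, hv⟩
          have := hg (vsub_mem_vectorSpan ℝ hvF hv₀F)
          simp only [vsub_eq_sub, LinearMap.mem_ker, map_sub] at this
          rw [affineValues_apply]
          dsimp only
          linarith
        have heq := eq_smul_of_mem_extremePoints hw ⟨_, rfl⟩ hgs
        set κ := ∑ v, affineValues s (g, -g v₀) v with hκ
        have hker : vectorSpan ℝ Q ≤ LinearMap.ker (g - κ • l) := by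
          rw [hD, Submodule.span_le]
          rintro _ ⟨v, hv, rfl⟩
          have h1 := congrFun heq ⟨v, hv⟩
          simp only [affineValues_apply, Pi.smul_apply, smul_eq_mul] at h1
          simp only [SetLike.mem_coe, LinearMap.mem_ker, LinearMap.sub_apply, LinearMap.smul_apply,
            smul_eq_mul, map_sub]
          have h2 : c = -l v₀ := by linarith
          rw [h2] at h1
          linarith
        have h3 := hker hxD
        have h4 : l x = 0 := hxl
        simp only [LinearMap.mem_ker, LinearMap.sub_apply, LinearMap.smul_apply, h4, smul_eq_mul,
          mul_zero, sub_zero] at h3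
        exact hgx h3
    obtain ⟨v₁, hv₁⟩ : ∃ v₁ : s, affineValues s (l, c) v₁ ≠ 0 := by
      by_contra! h
      have := hw.1.2.2
      simp [h] at this
    have hv₁' : (v₁ : Fin d → ℝ) - v₀ ∈ vectorSpan ℝ Q :=
      vsub_mem_vectorSpan ℝ (hsQ v₁ v₁.2) (hsQ v₀ hv₀)
    have hl₁ : l (v₁ - v₀) ≠ 0 := by
      rw [affineValues_apply] at hv₁
      rw [map_sub]
      intro h
      exact hv₁ (by dsimp only; linarith)
    have hrank := LinearMap.finrank_range_add_finrank_ker (l.domRestrict (vectorSpan ℝ Q))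
    have hsurj : LinearMap.range (l.domRestrict (vectorSpan ℝ Q)) = ⊤ := by
      rw [LinearMap.range_eq_top]
      apply LinearMap.surjective
      intro h
      exact hl₁ (LinearMap.congr_fun h ⟨_, hv₁'⟩)
    rw [hsurj, finrank_top, Module.finrank_self] at hrank
    have hker : Module.finrank ℝ (LinearMap.ker (l.domRestrict (vectorSpan ℝ Q))) =
        Module.finrank ℝ (vectorSpan ℝ F) := by
      rw [hFD, ← Submodule.map_comap_subtype, LinearMap.ker_domRestrict]
      exact ((Submodule.equivMapOfInjective _ (Submodule.injective_subtype _) _).finrank_eq)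
    omega

/-- The nonnegative affine functionals on a polytope are the nonnegative combinations of at most
as many of them as there are facets, unless the polytope is a point. -/
theorem IsPolytope.exists_generators {Q : Set (Fin d → ℝ)} (hQ : IsPolytope Q) :
    ∃ (r : ℕ) (l : Fin r → (Fin d → ℝ) →ₗ[ℝ] ℝ) (c : Fin r → ℝ),
      ((r : ℕ∞) ≤ numFacets Q ∨ r ≤ 1) ∧ (∀ t, ∀ y ∈ Q, 0 ≤ c t + l t y) ∧
      ∀ (φ : (Fin d → ℝ) →ₗ[ℝ] ℝ) (b : ℝ), (∀ y ∈ Q, 0 ≤ b + φ y) →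
        ∃ a : Fin r → ℝ, (∀ t, 0 ≤ a t) ∧ ∀ y ∈ Q, b + φ y = ∑ t, a t * (c t + l t y) := by
  classical
  obtain ⟨S, hS, rfl⟩ := hQ
  obtain ⟨s, rfl⟩ := hS.exists_finset_coe
  set X := (finite_extremePoints_affineBase s).toFinset with hX
  have hXmem : ∀ w, w ∈ X ↔ w ∈ (affineBase s).extremePoints ℝ := fun w =>
    Set.Finite.mem_toFinset _
  have hp : ∀ w : X, ∃ p, affineValues s p = w := fun w => ((hXmem w).1 w.2).1.1
  choose p hp using hp
  set e := X.equivFin with he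
  refine ⟨X.card, fun t => (p (e.symm t)).1, fun t => (p (e.symm t)).2, ?_, ?_, ?_⟩
  -- An extreme functional with no zero would be the only extreme point. So with two or more of them
  -- each vanishes at a point of `s` and defines a facet, distinct ones defining distinct facets.
  · by_cases hX1 : X.card ≤ 1
    · exact Or.inr hX1
    left
    have hzero : ∀ w : X, ∃ v : s, w.1 v = 0 := by
      intro w
      by_contra! h
      refine hX1 (card_le_one_iff.2 ?_)
      have : ∀ u ∈ X, u = w := fun u hu =>
        eq_of_mem_extremePoints ((hXmem _).1 w.2) ((hXmem u).1 hu).1 fun v hv => absurd hv (h v)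
      intro u u' hu hu'
      rw [this u hu, this u' hu']
    set Φ : X → Set (Fin d → ℝ) := fun w =>
      {y | y ∈ convexHull ℝ (s : Set (Fin d → ℝ)) ∧ (p w).2 + (p w).1 y = 0} with hΦ
    have hinj : Function.Injective Φ := by
      intro w u h
      refine Subtype.ext (eq_of_mem_extremePoints ((hXmem _).1 u.2) ((hXmem _).1 w.2).1 ?_)
      intro v hv
      have hvu : (v : Fin d → ℝ) ∈ Φ u := ⟨subset_convexHull ℝ _ v.2, by
        rw [← hp u, affineValues_apply] at hv
        exact hv⟩
      rw [← h] at hvu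
      rw [← hp w, affineValues_apply]
      exact hvu.2
    have hfac : ∀ w, IsFacet (convexHull ℝ (s : Set (Fin d → ℝ))) (Φ w) := by
      intro w
      obtain ⟨v, hv⟩ := hzero w
      refine isFacet_of_mem_extremePoints (c := (p w).2) (l := (p w).1) ?_ v.2 ?_
      · rw [Prod.mk.eta, hp]
        exact (hXmem _).1 w.2
      · rw [← hp w, affineValues_apply] at hv
        exact hv
    rw [numFacets]
    calc (X.card : ℕ∞) = (Set.range Φ).encard := by
          rw [← Set.image_univ, hinj.encard_image, Set.encard_univ]
          simp
      _ ≤ _ := Set.encard_le_encard (by rintro _ ⟨w, rfl⟩; exact hfac w)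
  · intro t
    refine nonneg_on_convexHull fun v hv => ?_
    have h1 := ((hXmem _).1 (e.symm t).2).1.2.1 ⟨v, hv⟩
    rw [← hp, affineValues_apply] at h1
    exact h1
  · intro φ b hb
    set u := affineValues s (φ, b) with hu
    have hu0 : ∀ v, 0 ≤ u v := fun v => hb v (subset_convexHull ℝ _ v.2)
    have key : ∃ a : (s → ℝ) → ℝ, (∀ w ∈ X, 0 ≤ a w) ∧ ∑ w ∈ X, a w • w = u := by
      have hsum : 0 ≤ ∑ v, u v := sum_nonneg fun v _ => hu0 v
      rcases hsum.eq_or_lt with h | h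
      · refine ⟨0, by simp, ?_⟩
        ext v
        simp [(sum_eq_zero_iff_of_nonneg fun v _ => hu0 v).1 h.symm v (mem_univ v)]
      · have hmem : (∑ v, u v)⁻¹ • u ∈ affineBase s := by
          refine ⟨Submodule.smul_mem _ _ ⟨_, rfl⟩, fun v => ?_, ?_⟩
          · exact mul_nonneg (inv_nonneg.2 hsum) (hu0 v)
          · simp only [Pi.smul_apply, smul_eq_mul, ← mul_sum]
            exact inv_mul_cancel₀ h.ne'
        rw [← convexHull_extremePoints_affineBase, ← (finite_extremePoints_affineBase s).coe_toFinset,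
          Finset.mem_convexHull'] at hmem
        obtain ⟨a, ha, -, hau⟩ := hmem
        refine ⟨fun w => (∑ v, u v) * a w, fun w hw => mul_nonneg hsum (ha w hw), ?_⟩
        simp only [mul_smul, ← smul_sum]
        rw [hau, smul_smul, mul_inv_cancel₀ h.ne', one_smul]
    obtain ⟨a, ha, hau⟩ := key
    refine ⟨fun t => a (e.symm t), fun t => ha _ (e.symm t).2, ?_⟩
    have hs : ∀ v ∈ s, b + φ v = ∑ t, a (e.symm t) * ((p (e.symm t)).2 + (p (e.symm t)).1 v) := by
      intro v hv
      have h1 := congrFun hau ⟨v, hv⟩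
      rw [hu, affineValues_apply] at h1
      rw [← h1, e.symm.sum_comp (fun w : X => a w * ((p w).2 + (p w).1 v)),
        ← sum_coe_sort X, Finset.sum_apply]
      refine sum_congr rfl fun w _ => ?_
      rw [Pi.smul_apply, smul_eq_mul, ← affineValues_apply s (p w) ⟨v, hv⟩, hp]
    set L : (Fin d → ℝ) →ₗ[ℝ] ℝ := φ - ∑ t, a (e.symm t) • (p (e.symm t)).1 with hL
    set C : ℝ := ∑ t, a (e.symm t) * (p (e.symm t)).2 - b with hC
    have hLy : ∀ y, L y = C ↔
        b + φ y = ∑ t, a (e.symm t) * ((p (e.symm t)).2 + (p (e.symm t)).1 y) := by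
      intro y
      simp only [hL, hC, LinearMap.sub_apply, LinearMap.sum_apply, LinearMap.smul_apply,
        smul_eq_mul, mul_add, sum_add_distrib]
      constructor <;> intro h <;> linarith
    have hsub : convexHull ℝ (s : Set (Fin d → ℝ)) ⊆ {y | L y = C} :=
      convexHull_min (fun v hv => (hLy v).2 (hs v hv)) (convex_hyperplane L.isLinear _)
    exact fun y hy => (hLy y).1 (hsub hy)

/-- The slacks of all valid inequalities of a polytope factor through the facets of an extended
formulation. -/
theorem IsExtendedFormulation.exists_factorization {E : Type*} [AddCommGroup E] [Module ℝ E]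
    {Q : Set (Fin d → ℝ)} {π : (Fin d → ℝ) →ₗ[ℝ] E} {K : Set E}
    (h : IsExtendedFormulation Q π K) :
    ∃ (r : ℕ) (g : Fin r → E → ℝ), ((r : ℕ∞) ≤ numFacets Q ∨ r ≤ 1) ∧
      (∀ t, ∀ x ∈ K, 0 ≤ g t x) ∧
      ∀ (φ : E →ₗ[ℝ] ℝ) (b : ℝ), (∀ x ∈ K, 0 ≤ b + φ x) →
        ∃ a : Fin r → ℝ, (∀ t, 0 ≤ a t) ∧ ∀ x ∈ K, b + φ x = ∑ t, a t * g t x := by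
  obtain ⟨hQ, rfl⟩ := h
  obtain ⟨r, l, c, hr, hnn, hgen⟩ := hQ.exists_generators
  have hy : ∀ x : E, ∃ y, x ∈ π '' Q → y ∈ Q ∧ π y = x := fun x => by
    by_cases hx : x ∈ π '' Q
    · obtain ⟨y, hy⟩ := hx
      exact ⟨y, fun _ => hy⟩
    · exact ⟨0, fun h => absurd h hx⟩
  choose y hy using hy
  refine ⟨r, fun t x => c t + l t (y x), hr, fun t x hx => hnn t _ (hy x hx).1, ?_⟩
  intro φ b hb
  obtain ⟨a, ha, hab⟩ := hgen (φ ∘ₗ π) b fun z hz => hb _ ⟨z, hz, rfl⟩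
  refine ⟨a, ha, fun x hx => ?_⟩
  rw [← hab _ (hy x hx).1, LinearMap.comp_apply, (hy x hx).2]

end Polytope

/-! ### The matching polytope and the odd set inequalities. -/

section Matching

open Finset

variable {n : ℕ}

/-- The indicator vector of a set of edges. -/
def edgeVector (M : Finset (Sym2 (Fin n))) : CompleteEdge n → ℝ :=
  fun e => if (e : Sym2 (Fin n)) ∈ M then 1 else 0

open Classical in
/-- The total value of the edges inside a vertex set. -/
noncomputable def insideSum (U : Finset (Fin n)) : (CompleteEdge n → ℝ) →ₗ[ℝ] ℝ :=
  ∑ e : CompleteEdge n, if ∀ v ∈ (e : Sym2 (Fin n)), v ∈ U then LinearMap.proj e else 0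

open Classical in
lemma insideSum_apply (U : Finset (Fin n)) (x : CompleteEdge n → ℝ) :
    insideSum U x = ∑ e : CompleteEdge n, if ∀ v ∈ (e : Sym2 (Fin n)), v ∈ U then x e else 0 := by
  rw [insideSum, LinearMap.sum_apply]
  refine sum_congr rfl fun e _ => ?_
  split_ifs <;> simp

lemma mem_matchingPolytope_of_isMatching {M : (⊤ : SimpleGraph (Fin n)).Subgraph}
    (hM : M.IsMatching) {x : CompleteEdge n → ℝ}
    (hx : ∀ e : CompleteEdge n, (e : Sym2 (Fin n)) ∈ M.edgeSet ∧ x e = 1 ∨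
      (e : Sym2 (Fin n)) ∉ M.edgeSet ∧ x e = 0) :
    x ∈ matchingPolytope n := by
  refine subset_convexHull ℝ _ ⟨M, hM, ?_⟩
  ext e
  rcases hx e with ⟨h, h'⟩ | ⟨h, h'⟩
  · rw [h', Set.indicator_of_mem (by exact h)]
    rfl
  · rw [h', Set.indicator_of_notMem (by exact h)]

lemma zero_mem_matchingPolytope : (0 : CompleteEdge n → ℝ) ∈ matchingPolytope n :=
  mem_matchingPolytope_of_isMatching (M := ⊥) (fun v hv => by simp at hv)
    fun e => Or.inr ⟨by simp, rfl⟩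

lemma single_mem_matchingPolytope (e : CompleteEdge n) :
    (Pi.single e 1 : CompleteEdge n → ℝ) ∈ matchingPolytope n := by
  obtain ⟨e, he⟩ := e
  induction e using Sym2.ind with
  | _ u v =>
    have hadj : (⊤ : SimpleGraph (Fin n)).Adj u v := he
    refine mem_matchingPolytope_of_isMatching
      (SimpleGraph.Subgraph.IsMatching.subgraphOfAdj hadj) fun f => ?_
    by_cases h : f = ⟨s(u, v), he⟩
    · subst h
      exact Or.inl ⟨by rw [SimpleGraph.edgeSet_subgraphOfAdj]; rfl, by simp⟩
    · refine Or.inr ⟨fun h' => h (Subtype.ext ?_), by simp [h]⟩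
      rw [SimpleGraph.edgeSet_subgraphOfAdj] at h'
      exact h'

/-- The matching whose edges are the edges in the cells of `S`. -/
def cellSubgraph {k B : ℕ} (σ : Position k B ↪ Fin n) (S : Finset (Option (Fin k × Fin B))) :
    (⊤ : SimpleGraph (Fin n)).Subgraph where
  verts := {v | ∃ c ∈ S, ∃ t, v = σ (some (c, t))}
  Adj u v := ∃ c ∈ S, ∃ t, u = σ (some (c, t)) ∧ v = σ (some (c, !t))
  adj_sub := by
    rintro u v ⟨c, -, t, rfl, rfl⟩
    simp
  edge_vert := by
    rintro u v ⟨c, hc, t, rfl, -⟩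
    exact ⟨c, hc, t, rfl⟩
  symm := ⟨by
    rintro u v ⟨c, hc, t, rfl, rfl⟩
    exact ⟨c, hc, !t, rfl, by simp⟩⟩

lemma isMatching_cellSubgraph {k B : ℕ} (σ : Position k B ↪ Fin n)
    (S : Finset (Option (Fin k × Fin B))) : (cellSubgraph σ S).IsMatching := by
  rintro v ⟨c, hc, t, rfl⟩
  refine ⟨σ (some (c, !t)), ⟨c, hc, t, rfl, rfl⟩, ?_⟩
  rintro w ⟨c', -, t', h, rfl⟩
  have := σ.injective h
  simp only [Option.some.injEq, Prod.mk.injEq] at this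
  rw [this.1, this.2]

lemma mem_edgeSet_cellSubgraph {k B : ℕ} (σ : Position k B ↪ Fin n)
    (S : Finset (Option (Fin k × Fin B))) (e : Sym2 (Fin n)) :
    e ∈ (cellSubgraph σ S).edgeSet ↔ e ∈ cellEdges σ S := by
  induction e using Sym2.ind with
  | _ u v =>
    rw [SimpleGraph.Subgraph.mem_edgeSet, cellEdges, mem_image]
    constructor
    · rintro ⟨c, hc, t, rfl, rfl⟩
      refine ⟨c, hc, ?_⟩
      cases t
      · rfl
      · exact Sym2.eq_swap
    · rintro ⟨c, hc, h⟩
      rw [cellEdge, Sym2.eq_iff] at h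
      rcases h with ⟨rfl, rfl⟩ | ⟨rfl, rfl⟩
      · exact ⟨c, hc, false, rfl, rfl⟩
      · exact ⟨c, hc, true, rfl, rfl⟩

lemma edgeVector_cellEdges_mem {k B : ℕ} (σ : Position k B ↪ Fin n)
    (S : Finset (Option (Fin k × Fin B))) :
    edgeVector (cellEdges σ S) ∈ matchingPolytope n := by
  refine mem_matchingPolytope_of_isMatching (isMatching_cellSubgraph σ S) fun e => ?_
  by_cases h : (e : Sym2 (Fin n)) ∈ cellEdges σ S
  · exact Or.inl ⟨(mem_edgeSet_cellSubgraph σ S e).2 h, if_pos h⟩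
  · exact Or.inr ⟨fun h' => h ((mem_edgeSet_cellSubgraph σ S e).1 h'), if_neg h⟩

/-- A matching has at most `|U| / 2` edges inside `U`. -/
lemma two_mul_card_edges_le {M : (⊤ : SimpleGraph (Fin n)).Subgraph} (hM : M.IsMatching)
    (U : Finset (Fin n)) (T : Finset (CompleteEdge n))
    (hT : ∀ e ∈ T, (e : Sym2 (Fin n)) ∈ M.edgeSet ∧ ∀ v ∈ (e : Sym2 (Fin n)), v ∈ U) :
    2 * T.card ≤ U.card := by
  classical
  have h := sum_card_bipartiteAbove_eq_sum_card_bipartiteBelow (s := T) (t := U)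
    (fun (e : CompleteEdge n) (v : Fin n) => v ∈ (e : Sym2 (Fin n)))
  have h1 : ∀ e ∈ T, (bipartiteAbove (fun (e : CompleteEdge n) v => v ∈ (e : Sym2 (Fin n))) U
      e).card = 2 := by
    rintro ⟨e, he⟩ heT
    obtain ⟨-, hU⟩ := hT _ heT
    induction e using Sym2.ind with
    | _ u v =>
      have huv : u ≠ v := by simpa using he
      rw [card_eq_two]
      refine ⟨u, v, huv, ?_⟩
      ext w
      simp only [bipartiteAbove, mem_filter, Sym2.mem_iff, mem_insert, mem_singleton]
      refine ⟨fun h => h.2, fun h => ⟨hU w ?_, h⟩⟩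
      simpa using h
  have h2 : ∀ v ∈ U, (bipartiteBelow (fun (e : CompleteEdge n) v => v ∈ (e : Sym2 (Fin n))) T
      v).card ≤ 1 := by
    intro v _
    rw [card_le_one]
    intro e he e' he'
    simp only [bipartiteBelow, mem_filter] at he he'
    have h3 := (hT e he.1).1
    have h4 := (hT e' he'.1).1
    obtain ⟨w, hw⟩ := he.2
    obtain ⟨w', hw'⟩ := he'.2
    rw [hw, SimpleGraph.Subgraph.mem_edgeSet] at h3
    rw [hw', SimpleGraph.Subgraph.mem_edgeSet] at h4
    apply Subtype.ext
    rw [hw, hw', (hM (M.edge_vert h3)).unique h3 h4]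
  rw [sum_congr rfl h1, sum_const, smul_eq_mul] at h
  have h3 := sum_le_sum h2
  rw [← h] at h3
  simp only [sum_const, smul_eq_mul, mul_one] at h3
  linarith

lemma insideSum_le_of_mem_matchingPolytope {U : Finset (Fin n)} (hU : Odd U.card)
    {x : CompleteEdge n → ℝ} (hx : x ∈ matchingPolytope n) :
    2 * insideSum U x ≤ U.card - 1 := by
  classical
  have hsub : matchingPolytope n ⊆ {x | insideSum U x ≤ ((U.card : ℝ) - 1) / 2} := by
    refine convexHull_min ?_ (convex_halfSpace_le (insideSum U).isLinear _)
    rintro _ ⟨M, hM, rfl⟩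
    have hcard := two_mul_card_edges_le hM U
      (univ.filter fun e : CompleteEdge n => (e : Sym2 (Fin n)) ∈ M.edgeSet ∧
        ∀ v ∈ (e : Sym2 (Fin n)), v ∈ U) (fun e he => (mem_filter.1 he).2)
    have hsum : insideSum U (Set.indicator {e : CompleteEdge n | (e : Sym2 (Fin n)) ∈ M.edgeSet} 1)
        = (univ.filter fun e : CompleteEdge n => (e : Sym2 (Fin n)) ∈ M.edgeSet ∧
        ∀ v ∈ (e : Sym2 (Fin n)), v ∈ U).card := by
      rw [insideSum_apply, card_filter]
      push_cast
      refine sum_congr rfl fun e _ => ?_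
      by_cases h : (e : Sym2 (Fin n)) ∈ M.edgeSet
      · rw [Set.indicator_of_mem (by exact h)]
        simp [h]
      · rw [Set.indicator_of_notMem (by exact h)]
        simp [h]
    rw [Set.mem_ofPred_eq, hsum]
    obtain ⟨m, hm⟩ := hU
    rw [hm] at hcard ⊢
    have : (univ.filter fun e : CompleteEdge n => (e : Sym2 (Fin n)) ∈ M.edgeSet ∧
        ∀ v ∈ (e : Sym2 (Fin n)), v ∈ U).card ≤ m := by omega
    push_cast
    have h2 : ((univ.filter fun e : CompleteEdge n => (e : Sym2 (Fin n)) ∈ M.edgeSet ∧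
        ∀ v ∈ (e : Sym2 (Fin n)), v ∈ U).card : ℝ) ≤ m := by exact_mod_cast this
    linarith
  have := hsub hx
  rw [Set.mem_ofPred_eq] at this
  linarith

lemma nonneg_of_mem_matchingPolytope {x : CompleteEdge n → ℝ} (hx : x ∈ matchingPolytope n)
    (e : CompleteEdge n) : 0 ≤ x e := by
  have hsub : matchingPolytope n ⊆ {x | 0 ≤ LinearMap.proj (R := ℝ) (φ := fun _ => ℝ) e x} := by
    refine convexHull_min ?_ (convex_halfSpace_ge (LinearMap.isLinear _) _)
    rintro _ ⟨M, -, rfl⟩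
    exact Set.indicator_nonneg (fun _ _ => zero_le_one' ℝ) e
  exact hsub hx

lemma card_chosenVertices {k B : ℕ} (σ : Position k B ↪ Fin n) (a : Fin k → Fin B) :
    (chosenVertices σ a).card = 2 * k + 3 := by
  rw [chosenVertices, card_map, chosenPositions, card_filter, Fintype.sum_option,
    Fintype.sum_prod_type, Fintype.sum_option]
  simp only [Fintype.sum_prod_type, Fintype.sum_bool]
  have h : ∀ (j : Fin k) (i : Fin B) (t : Bool),
      (∀ q ∈ (some (some (j, i), t) : Position k B), ∀ c ∈ q.1, a c.1 = c.2) ↔ a j = i := by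
    intro j i t
    simp only [Option.mem_def, Option.some.injEq, forall_eq']
  simp only [h]
  simp [sum_add_distrib]
  ring

lemma cellEdge_mem_edgeSet {k B : ℕ} (σ : Position k B ↪ Fin n) (c : Option (Fin k × Fin B)) :
    cellEdge σ c ∈ (⊤ : SimpleGraph (Fin n)).edgeSet := by
  simp [cellEdge]

lemma cellEdge_injective {k B : ℕ} (σ : Position k B ↪ Fin n) :
    Function.Injective (cellEdge σ) := by
  intro c c' h
  rw [cellEdge, cellEdge, Sym2.eq_iff] at h
  rcases h with ⟨h, -⟩ | ⟨h, -⟩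
  · have := σ.injective h
    simp only [Option.some.injEq, Prod.mk.injEq] at this
    exact this.1
  · have := σ.injective h
    simp at this

lemma cellEdge_inside_iff {k B : ℕ} (σ : Position k B ↪ Fin n) (a : Fin k → Fin B)
    (c : Option (Fin k × Fin B)) :
    (∀ v ∈ cellEdge σ c, v ∈ chosenVertices σ a) ↔ ∀ d ∈ c, a d.1 = d.2 := by
  have h : ∀ t, σ (some (c, t)) ∈ chosenVertices σ a ↔ ∀ d ∈ c, a d.1 = d.2 := by
    intro t
    rw [chosenVertices, mem_map' σ, chosenPositions, mem_filter]
    simp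
  simp only [cellEdge, Sym2.mem_iff, forall_eq_or_imp, forall_eq, h, and_self]

lemma insideSum_edgeVector {k B : ℕ} (σ : Position k B ↪ Fin n) (a : Fin k → Fin B)
    (t : Bool) (b : Fin k → Fin B → Fin 16) :
    insideSum (chosenVertices σ a) (edgeVector (cellEdges σ (pairedCells t b))) =
      (if t = true then 1 else 0) + ∑ j, if b j (a j) ≠ 0 then 1 else 0 := by
  classical
  have h1 : insideSum (chosenVertices σ a) (edgeVector (cellEdges σ (pairedCells t b))) =
      ∑ c ∈ pairedCells t b, if ∀ d ∈ c, a d.1 = d.2 then (1 : ℝ) else 0 := by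
    rw [insideSum_apply]
    set ι : Option (Fin k × Fin B) ↪ CompleteEdge n :=
      ⟨fun c => ⟨cellEdge σ c, cellEdge_mem_edgeSet σ c⟩, fun c c' h =>
        cellEdge_injective σ (congrArg Subtype.val h)⟩ with hι
    have hmem : ∀ e : CompleteEdge n, (e : Sym2 (Fin n)) ∈ cellEdges σ (pairedCells t b) ↔
        e ∈ (pairedCells t b).map ι := by
      intro e
      simp only [cellEdges, mem_image, mem_map, Subtype.ext_iff]
      exact Iff.rfl
    have h2 : ∀ e : CompleteEdge n, (if ∀ v ∈ (e : Sym2 (Fin n)), v ∈ chosenVertices σ a then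
        edgeVector (cellEdges σ (pairedCells t b)) e else 0) =
        if e ∈ (pairedCells t b).map ι then
          (if ∀ v ∈ (e : Sym2 (Fin n)), v ∈ chosenVertices σ a then 1 else 0) else 0 := by
      intro e
      simp only [edgeVector, hmem]
      split_ifs <;> rfl
    simp only [h2]
    rw [sum_ite_mem, univ_inter, sum_map]
    refine sum_congr rfl fun c _ => ?_
    exact if_congr (cellEdge_inside_iff σ a c) rfl rfl
  rw [h1]
  have h3 : ∑ c ∈ pairedCells t b, (if ∀ d ∈ c, a d.1 = d.2 then (1 : ℝ) else 0) =
      ∑ c, if c ∈ pairedCells t b then (if ∀ d ∈ c, a d.1 = d.2 then (1 : ℝ) else 0) else 0 := by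
    rw [sum_ite_mem, univ_inter]
  rw [h3, Fintype.sum_option, Fintype.sum_prod_type]
  simp only [none_mem_pairedCells, some_mem_pairedCells, Option.mem_def, reduceCtorEq,
    false_imp_iff, implies_true, if_true, Option.some.injEq, forall_eq']
  congr 1
  refine sum_congr rfl fun j _ => ?_
  rw [sum_eq_single (a j)]
  · simp
  · intro i _ hi
    simp [Ne.symm hi]
  · simp

/-- In a factorization of the slacks there are at least `n` factors. -/
lemma le_card_factors {K : Set (CompleteEdge n → ℝ)} {ε : ℝ} (hε : 0 ≤ ε)
    (h₁ : matchingPolytope n ⊆ K) (h₂ : K ⊆ (1 + ε) • matchingPolytope n) (hn : 0 < n) {r : ℕ}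
    {g : Fin r → (CompleteEdge n → ℝ) → ℝ}
    (hg : ∀ (φ : (CompleteEdge n → ℝ) →ₗ[ℝ] ℝ) (b : ℝ), (∀ x ∈ K, 0 ≤ b + φ x) →
        ∃ a : Fin r → ℝ, (∀ t, 0 ≤ a t) ∧ ∀ x ∈ K, b + φ x = ∑ t, a t * g t x) : n ≤ r := by
  classical
  set pt : Option (CompleteEdge n) → (CompleteEdge n → ℝ) :=
    fun o => o.elim 0 fun e => Pi.single e 1 with hpt
  have hptK : ∀ o, pt o ∈ K := by
    rintro (_ | e)
    · exact h₁ zero_mem_matchingPolytope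
    · exact h₁ (single_mem_matchingPolytope e)
  -- The constant 1 and the coordinates are valid functionals that separate the origin and the unit
  -- vectors, so the `n.choose 2 + 1` vectors of factor values are independent.
  have hli : LinearIndependent ℝ (fun o t => g t (pt o)) := by
    rw [Fintype.linearIndependent_iff]
    intro κ hκ
    have key : ∀ (φ : (CompleteEdge n → ℝ) →ₗ[ℝ] ℝ) (b : ℝ), (∀ x ∈ K, 0 ≤ b + φ x) →
        ∑ o, κ o * (b + φ (pt o)) = 0 := by
      intro φ b hb
      obtain ⟨a, -, ha⟩ := hg φ b hb
      simp only [ha _ (hptK _), mul_sum]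
      rw [sum_comm]
      refine sum_eq_zero fun t _ => ?_
      have := congrFun hκ t
      simp only [Finset.sum_apply, Pi.smul_apply, smul_eq_mul, Pi.zero_apply] at this
      calc ∑ o, κ o * (a t * g t (pt o)) = a t * ∑ o, κ o * g t (pt o) := by
            rw [mul_sum]
            exact sum_congr rfl fun o _ => by ring
        _ = 0 := by rw [this, mul_zero]
    have hsome : ∀ e, κ (some e) = 0 := by
      intro e
      have h := key (LinearMap.proj e) 0 fun x hx => by
        obtain ⟨p, hp, rfl⟩ := h₂ hx
        have := nonneg_of_mem_matchingPolytope hp e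
        simp only [LinearMap.proj_apply, Pi.smul_apply, smul_eq_mul, zero_add]
        positivity
      rw [Fintype.sum_option] at h
      simpa [hpt, Pi.single_apply] using h
    have hnone : κ none = 0 := by
      have h := key 0 1 fun x _ => by simp
      rw [Fintype.sum_option] at h
      simpa [hsome] using h
    rintro (_ | e)
    · exact hnone
    · exact hsome e
  have hcard := hli.fintype_card_le_finrank
  rw [Module.finrank_fintype_fun_eq_card, Fintype.card_fin, Fintype.card_option] at hcard
  have hc : Fintype.card (CompleteEdge n) = n.choose 2 := by
    rw [← SimpleGraph.edgeFinset_card, SimpleGraph.card_edgeFinset_top_eq_card_choose_two,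
      Fintype.card_fin]
  obtain ⟨m, rfl⟩ := Nat.exists_eq_succ_of_ne_zero hn.ne'
  rw [hc, Nat.succ_eq_add_one, Nat.choose_succ_succ, Nat.choose_one_right] at hcard
  omega

end Matching

/-! ### Total weights of a factorization, and rescaling. -/

section Slack

open Finset

variable {k B : ℕ}

lemma card_singleAt (i : Fin B) : (singleAt i).card = 16 ^ (B - 1) := by
  have h : singleAt i = Fintype.piFinset
      fun x => if x = i then ({0} : Finset (Fin 16)) else univ := by
    ext β
    simp only [singleAt, mem_filter, mem_univ, true_and, Fintype.mem_piFinset]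
    refine ⟨fun h x => ?_, fun h => by simpa using h i⟩
    by_cases hx : x = i
    · subst hx; simpa using h
    · simp [hx]
  rw [h, Fintype.card_piFinset, ← mul_prod_erase univ _ (mem_univ i)]
  rw [prod_congr rfl (g := fun _ => 16)]
  · simp
  · intro x hx
    simp [(mem_erase.1 hx).1]

lemma sum_pairedTotal_eq {r : ℕ} {F : Fin r → (Fin k → Fin B) → ℝ}
    {G : Fin r → (Fin k → Fin B → Fin 16) → ℝ} {v : ℝ}
    (h : ∀ a b, (∀ x, b x (a x) ≠ 0) → ∑ t, F t a * G t b = v) :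
    ∑ t, pairedTotal (F t) (G t) = (B * (15 * 16 ^ (B - 1))) ^ k * v := by
  have h1 : ∀ a : Fin k → Fin B, ∑ b : Fin k → Fin B → Fin 16, (if ∀ x, b x (a x) ≠ 0 then v else 0)
      = (15 * 16 ^ (B - 1)) ^ k * v := by
    intro a
    have h2 : (univ.filter fun b : Fin k → Fin B → Fin 16 => ∀ x, b x (a x) ≠ 0) =
        Fintype.piFinset fun x => pairedAt (a x) := by
      ext b
      simp [pairedAt]
    rw [← sum_filter, h2, sum_const, Fintype.card_piFinset, prod_congr rfl fun x _ =>
      card_pairedAt (a x), prod_const, card_univ, Fintype.card_fin, nsmul_eq_mul]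
    push_cast
    ring
  calc ∑ t, pairedTotal (F t) (G t)
      = ∑ a : Fin k → Fin B, ∑ b : Fin k → Fin B → Fin 16,
        if ∀ x, b x (a x) ≠ 0 then v else 0 := by
        simp only [pairedTotal]
        rw [sum_comm]
        refine sum_congr rfl fun a _ => ?_
        rw [sum_comm]
        refine sum_congr rfl fun b _ => ?_
        split_ifs with hab
        · exact h a b hab
        · exact sum_const_zero
    _ = _ := by
        simp only [h1, sum_const, card_univ, Fintype.card_fun, Fintype.card_fin, nsmul_eq_mul]
        push_cast
        ring

/-- Row `j` has `16 ^ (B - 1)` admissible states instead of `15 * 16 ^ (B - 1)`; the factor 15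
restores the count of the paired case. -/
lemma sum_singleTotal_eq {r : ℕ} {F : Fin r → (Fin k → Fin B) → ℝ}
    {G : Fin r → (Fin k → Fin B → Fin 16) → ℝ} {v : ℝ} (j : Fin k)
    (h : ∀ a b, (∀ x, x ≠ j → b x (a x) ≠ 0) → b j (a j) = 0 → ∑ t, F t a * G t b = v) :
    15 * ∑ t, singleTotal (F t) (G t) j = (B * (15 * 16 ^ (B - 1))) ^ k * v := by
  have h1 : ∀ a : Fin k → Fin B, 15 * ∑ b : Fin k → Fin B → Fin 16,
      (if (∀ x, x ≠ j → b x (a x) ≠ 0) ∧ b j (a j) = 0 then v else 0)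
      = (15 * 16 ^ (B - 1)) ^ k * v := by
    intro a
    have h2 : (univ.filter fun b : Fin k → Fin B → Fin 16 =>
        (∀ x, x ≠ j → b x (a x) ≠ 0) ∧ b j (a j) = 0) =
        Fintype.piFinset fun x => if x = j then singleAt (a x) else pairedAt (a x) := by
      ext b
      simp only [mem_filter, mem_univ, true_and, Fintype.mem_piFinset]
      constructor
      · rintro ⟨h, h'⟩ x
        by_cases hx : x = j
        · subst hx; simpa [singleAt] using h'
        · simpa [hx, pairedAt] using h x hx
      · intro h
        exact ⟨fun x hx => by simpa [hx, pairedAt] using h x, by simpa [singleAt] using h j⟩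
    have h3 : 15 * ∏ x, (if x = j then singleAt (a x) else pairedAt (a x)).card =
        (15 * 16 ^ (B - 1)) ^ k := by
      rw [← mul_prod_erase univ _ (mem_univ j), prod_congr rfl (g := fun _ => 15 * 16 ^ (B - 1))]
      · rw [prod_const, card_erase_of_mem (mem_univ j), card_univ, Fintype.card_fin, if_pos rfl,
          card_singleAt, ← mul_assoc, mul_pow_sub_one j.pos.ne']
      · intro x hx
        rw [if_neg (mem_erase.1 hx).1, card_pairedAt]
    rw [← sum_filter, h2, sum_const, Fintype.card_piFinset, nsmul_eq_mul, ← mul_assoc]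
    exact_mod_cast congrArg (fun m : ℕ => (m : ℝ) * v) h3
  calc 15 * ∑ t, singleTotal (F t) (G t) j
      = ∑ a : Fin k → Fin B, 15 * ∑ b : Fin k → Fin B → Fin 16,
        if (∀ x, x ≠ j → b x (a x) ≠ 0) ∧ b j (a j) = 0 then v else 0 := by
        simp only [singleTotal]
        rw [sum_comm, mul_sum]
        refine sum_congr rfl fun a _ => ?_
        rw [sum_comm]
        congr 1
        refine sum_congr rfl fun b _ => ?_
        split_ifs with hab
        · exact h a b hab.1 hab.2
        · exact sum_const_zero
    _ = _ := by
        simp only [h1, sum_const, card_univ, Fintype.card_fun, Fintype.card_fin, nsmul_eq_mul]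
        push_cast
        ring

lemma pairedTotal_smul (x y : ℝ) (F : (Fin k → Fin B) → ℝ) (G : (Fin k → Fin B → Fin 16) → ℝ) :
    pairedTotal (fun a => x * F a) (fun b => y * G b) = x * y * pairedTotal F G := by
  simp only [pairedTotal, mul_sum]
  refine sum_congr rfl fun a _ => sum_congr rfl fun b _ => ?_
  split_ifs
  · ring
  · ring

lemma singleTotal_smul (x y : ℝ) (F : (Fin k → Fin B) → ℝ) (G : (Fin k → Fin B → Fin 16) → ℝ)
    (j : Fin k) :
    singleTotal (fun a => x * F a) (fun b => y * G b) j = x * y * singleTotal F G j := by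
  simp only [singleTotal, mul_sum]
  refine sum_congr rfl fun a _ => sum_congr rfl fun b _ => ?_
  split_ifs
  · ring
  · ring

variable {V : Type*} [Fintype V] [DecidableEq V]

/-- Dividing `f` and `g` by their maxima reduces to weights bounded by 1. All terms but the error
are bilinear, so only the error acquires the factor `C`. -/
lemma placed_pairedTotal_le_of_mul_le {f : Finset V → ℝ} {g : Finset (Sym2 V) → ℝ} (hB : 0 < B)
    (hf : ∀ U, 0 ≤ f U) (hg : ∀ M, 0 ≤ g M) {C : ℝ} (hfg : ∀ U M, f U * g M ≤ C)
    {D l c : ℝ} (hc : 0 < c)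
    (hl : 200 * (200 * (c + 1) + 1) ≤ l) (hD : D * Real.exp l ≤ B)
    (hD' : 1 + 8195 * (200 * (200 * c)) ≤ D) :
    49 / 50 * (k * ∑ σ : Position k B ↪ V, pairedTotal (placedChoice f σ) (placedState g false σ)) ≤
      k * (Fintype.card (Position k B ↪ V) *
        (Real.exp (-(k * c)) * (B * (15 * 16 ^ (B - 1))) ^ k)) * C +
      10 ^ 4 * (k * ∑ σ : Position k B ↪ V,
        pairedTotal (placedChoice f σ) (placedState g true σ)) +
      (15 / 200 + 2 / 5 * (256 / 15)) * ∑ j : Fin k, ∑ σ : Position k B ↪ V,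
        singleTotal (placedChoice f σ) (placedState g false σ) j := by
  obtain ⟨U₀, -, hU₀⟩ := exists_max_image univ f univ_nonempty
  obtain ⟨M₀, -, hM₀⟩ := exists_max_image univ g univ_nonempty
  have hC : 0 ≤ C := (mul_nonneg (hf U₀) (hg M₀)).trans (hfg U₀ M₀)
  have h0 : ∀ U M, 0 ≤ f U * g M := fun U M => mul_nonneg (hf U) (hg M)
  by_cases hpos : 0 < f U₀ ∧ 0 < g M₀
  · obtain ⟨hx, hy⟩ := hpos
    have h := placed_pairedTotal_le (k := k) (f := fun U => (f U₀)⁻¹ * f U)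
      (g := fun M => (g M₀)⁻¹ * g M) hB
      (fun U => mul_nonneg (inv_nonneg.2 hx.le) (hf U))
      (fun U => by
        rw [inv_mul_eq_div, div_le_one hx]
        exact hU₀ U (mem_univ U))
      (fun M => mul_nonneg (inv_nonneg.2 hy.le) (hg M))
      (fun M => by
        rw [inv_mul_eq_div, div_le_one hy]
        exact hM₀ M (mem_univ M)) hc hl hD hD'
    have e1 : ∀ t (σ : Position k B ↪ V),
        pairedTotal (placedChoice (fun U => (f U₀)⁻¹ * f U) σ)
          (placedState (fun M => (g M₀)⁻¹ * g M) t σ) =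
        (f U₀)⁻¹ * (g M₀)⁻¹ * pairedTotal (placedChoice f σ) (placedState g t σ) :=
      fun t σ => pairedTotal_smul _ _ _ _
    have e2 : ∀ j (σ : Position k B ↪ V),
        singleTotal (placedChoice (fun U => (f U₀)⁻¹ * f U) σ)
          (placedState (fun M => (g M₀)⁻¹ * g M) false σ) j =
        (f U₀)⁻¹ * (g M₀)⁻¹ * singleTotal (placedChoice f σ) (placedState g false σ) j :=
      fun j σ => singleTotal_smul _ _ _ _ j
    simp only [e1, e2, ← mul_sum] at h
    have hxy : 0 < f U₀ * g M₀ := mul_pos hx hy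
    have h' := mul_le_mul_of_nonneg_left h hxy.le
    have hinv : f U₀ * g M₀ * ((f U₀)⁻¹ * (g M₀)⁻¹) = 1 := by
      field_simp
    set Z₀ := ∑ σ : Position k B ↪ V, pairedTotal (placedChoice f σ) (placedState g false σ)
    set Z₁ := ∑ σ : Position k B ↪ V, pairedTotal (placedChoice f σ) (placedState g true σ)
    set S := ∑ j : Fin k, ∑ σ : Position k B ↪ V,
        singleTotal (placedChoice f σ) (placedState g false σ) j
    set T : ℝ := k * (Fintype.card (Position k B ↪ V) *
        (Real.exp (-(k * c)) * (B * (15 * 16 ^ (B - 1))) ^ k)) with hT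
    have hT0 : 0 ≤ T := by positivity
    have hTC := mul_le_mul_of_nonneg_left (hfg U₀ M₀) hT0
    linear_combination h' + hTC + (49 / 50 * k * Z₀ - 10 ^ 4 * k * Z₁ -
      (15 / 200 + 2 / 5 * (256 / 15)) * S) * (-hinv)
  · have hz : ∀ U M, f U * g M = 0 := by
      intro U M
      rcases not_and_or.1 hpos with h | h
      · rw [le_antisymm ((hU₀ U (mem_univ U)).trans (not_lt.1 h)) (hf U), zero_mul]
      · rw [le_antisymm ((hM₀ M (mem_univ M)).trans (not_lt.1 h)) (hg M), mul_zero]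
    have e1 : ∀ t (σ : Position k B ↪ V),
        pairedTotal (placedChoice f σ) (placedState g t σ) = 0 := by
      intro t σ
      simp [pairedTotal, placedChoice, placedState, hz]
    have e2 : ∀ j (σ : Position k B ↪ V),
        singleTotal (placedChoice f σ) (placedState g false σ) j = 0 := by
      intro j σ
      simp [singleTotal, placedChoice, placedState, hz]
    simp only [e1, e2, sum_const_zero, mul_zero, add_zero]
    positivity

end Slack

/-! ### Exponentially many factors. -/

section Factorization

open Finset

variable {n k B : ℕ}

lemma insideSum_edgeVector_nonneg (U : Finset (Fin n)) (M : Finset (Sym2 (Fin n))) :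
    0 ≤ insideSum U (edgeVector M) := by
  classical
  rw [insideSum_apply]
  refine sum_nonneg fun e _ => ?_
  unfold edgeVector
  split_ifs <;> norm_num

lemma insideSum_edgeVector_of_paired (σ : Position k B ↪ Fin n) {a : Fin k → Fin B} (t : Bool)
    {b : Fin k → Fin B → Fin 16} (h : ∀ x, b x (a x) ≠ 0) :
    insideSum (chosenVertices σ a) (edgeVector (cellEdges σ (pairedCells t b))) =
      (if t = true then 1 else 0) + k := by
  rw [insideSum_edgeVector]
  simp [h]

lemma insideSum_edgeVector_of_single (σ : Position k B ↪ Fin n) {a : Fin k → Fin B} {j : Fin k}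
    {b : Fin k → Fin B → Fin 16} (h : ∀ x, x ≠ j → b x (a x) ≠ 0) (h' : b j (a j) = 0) :
    insideSum (chosenVertices σ a) (edgeVector (cellEdges σ (pairedCells false b))) = k - 1 := by
  rw [insideSum_edgeVector, ← add_sum_erase univ _ (mem_univ j), if_neg (not_not.2 h'),
    sum_congr rfl fun x hx => if_pos (h x (mem_erase.1 hx).1)]
  rw [sum_const, card_erase_of_mem (mem_univ j), card_univ, Fintype.card_fin, nsmul_eq_mul,
    Nat.cast_pred j.pos]
  simp

/-- A factorization of the slacks of the odd set inequalities has exponentially many factors. -/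
theorem exp_le_card_factors {K : Set (CompleteEdge n → ℝ)} {ε : ℝ} (hε : 0 ≤ ε)
    (h₁ : matchingPolytope n ⊆ K) (h₂ : K ⊆ (1 + ε) • matchingPolytope n) {r : ℕ}
    {g : Fin r → (CompleteEdge n → ℝ) → ℝ} (hg0 : ∀ t, ∀ x ∈ K, 0 ≤ g t x)
    (hg : ∀ (φ : (CompleteEdge n → ℝ) →ₗ[ℝ] ℝ) (b : ℝ), (∀ x ∈ K, 0 ≤ b + φ x) →
      ∃ a : Fin r → ℝ, (∀ t, 0 ≤ a t) ∧ ∀ x ∈ K, b + φ x = ∑ t, a t * g t x)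
    (hk : 0 < k) (hB : 0 < B) (hn : 2 * (k * B) + 3 ≤ n) (hτ : ε * (2 * k + 2) ≤ 1 / 10 ^ 6)
    {D l c : ℝ} (hc : 0 < c) (hl : 200 * (200 * (c + 1) + 1) ≤ l) (hD : D * Real.exp l ≤ B)
    (hD' : 1 + 8195 * (200 * (200 * c)) ≤ D) :
    Real.exp (k * c) ≤ 10 * (r * (4 * k + 4)) := by
  classical
  set τ := ε * (2 * k + 2) with hτdef
  have hτ0 : 0 ≤ τ := by positivity
  have hvalid : ∀ U : Finset (Fin n), U.card = 2 * k + 3 → ∀ x ∈ K,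
      0 ≤ (1 + ε) * (2 * k + 2) + ((-2 : ℝ) • insideSum U) x := by
    intro U hU x hx
    obtain ⟨p, hp, rfl⟩ := h₂ hx
    have h := insideSum_le_of_mem_matchingPolytope (U := U) (by rw [hU]; exact ⟨k + 1, by ring⟩) hp
    rw [hU] at h
    push_cast at h
    simp only [LinearMap.smul_apply, map_smul, smul_eq_mul]
    nlinarith
  have hex : ∀ U : Finset (Fin n), ∃ a : Fin r → ℝ, (∀ t, 0 ≤ a t) ∧ (U.card = 2 * k + 3 →
      ∀ x ∈ K, (1 + ε) * (2 * k + 2) - 2 * insideSum U x = ∑ t, a t * g t x) := by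
    intro U
    by_cases hU : U.card = 2 * k + 3
    · obtain ⟨a, ha0, ha⟩ := hg _ _ (hvalid U hU)
      refine ⟨a, ha0, fun _ x hx => ?_⟩
      rw [← ha x hx]
      simp only [LinearMap.smul_apply, smul_eq_mul]
      ring
    · exact ⟨0, fun _ => le_rfl, fun h => absurd h hU⟩
  choose A hA0 hA using hex
  set F : Fin r → Finset (Fin n) → ℝ := fun t U => if U.card = 2 * k + 3 then A U t else 0 with hF
  set G : Fin r → Finset (Sym2 (Fin n)) → ℝ :=
    fun t M => if edgeVector M ∈ K then g t (edgeVector M) else 0 with hG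
  have hF0 : ∀ t U, 0 ≤ F t U := by
    intro t U
    simp only [hF]
    split_ifs
    exacts [hA0 U t, le_rfl]
  have hG0 : ∀ t M, 0 ≤ G t M := by
    intro t M
    simp only [hG]
    split_ifs with h
    exacts [hg0 t _ h, le_rfl]
  have hFG : ∀ U M, U.card = 2 * k + 3 → edgeVector M ∈ K →
      ∑ t, F t U * G t M = (1 + ε) * (2 * k + 2) - 2 * insideSum U (edgeVector M) := by
    intro U M hU hM
    rw [hA U hU _ hM]
    exact sum_congr rfl fun t _ => by simp only [hF, hG, if_pos hU, if_pos hM]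
  -- A single summand is at most the whole slack, which is at most `2 * k + 2 + τ`.
  have hC : ∀ t U M, F t U * G t M ≤ 4 * k + 4 := by
    intro t U M
    by_cases hU : U.card = 2 * k + 3
    · by_cases hM : edgeVector M ∈ K
      · have h := single_le_sum (f := fun t => F t U * G t M)
          (fun t _ => mul_nonneg (hF0 t U) (hG0 t M)) (mem_univ t)
        have h' := insideSum_edgeVector_nonneg U M
        have hk0 : (0 : ℝ) ≤ k := Nat.cast_nonneg k
        simp only [hFG U M hU hM] at h
        nlinarith
      · simp only [hG, if_neg hM, mul_zero]
        positivity
    · simp only [hF, if_neg hU, zero_mul]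
      positivity
  set P : ℝ := ((Fintype.card (Position k B ↪ Fin n) : ℕ) : ℝ) with hP
  set N : ℝ := (B * (15 * 16 ^ (B - 1))) ^ k with hN
  have hP0 : 0 < P := by
    have : Nonempty (Position k B ↪ Fin n) := by
      refine Function.Embedding.nonempty_of_card_le ?_
      simp only [Position, Fintype.card_option, Fintype.card_prod, Fintype.card_fin,
        Fintype.card_bool]
      linarith
    rw [hP]
    exact_mod_cast Fintype.card_pos
  have hN0 : 0 < N := by positivity
  have hpaired : ∀ t, ∑ s, ∑ σ : Position k B ↪ Fin n,
      pairedTotal (placedChoice (F s) σ) (placedState (G s) t σ) =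
      P * (N * ((1 + ε) * (2 * k + 2) - 2 * ((if t = true then 1 else 0) + k))) := by
    intro t
    rw [sum_comm, sum_congr rfl fun σ _ => sum_pairedTotal_eq fun a b hab => ?_, sum_const,
      card_univ, nsmul_eq_mul]
    rw [← insideSum_edgeVector_of_paired σ t hab]
    exact hFG _ _ (card_chosenVertices σ a) (h₁ (edgeVector_cellEdges_mem σ _))
  have hsingle : ∀ j, 15 * ∑ s, ∑ σ : Position k B ↪ Fin n,
      singleTotal (placedChoice (F s) σ) (placedState (G s) false σ) j =
      P * (N * ((1 + ε) * (2 * k + 2) - 2 * (k - 1))) := by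
    intro j
    rw [sum_comm, mul_sum, sum_congr rfl fun σ _ => sum_singleTotal_eq j fun a b hab hab' => ?_,
      sum_const, card_univ, nsmul_eq_mul]
    rw [← insideSum_edgeVector_of_single σ hab hab']
    exact hFG _ _ (card_chosenVertices σ a) (h₁ (edgeVector_cellEdges_mem σ _))
  have hp0 : ∑ s, ∑ σ : Position k B ↪ Fin n,
      pairedTotal (placedChoice (F s) σ) (placedState (G s) false σ) = P * (N * (2 + τ)) := by
    rw [hpaired, hτdef, if_neg Bool.false_ne_true]
    ring
  have hp1 : ∑ s, ∑ σ : Position k B ↪ Fin n,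
      pairedTotal (placedChoice (F s) σ) (placedState (G s) true σ) = P * (N * τ) := by
    rw [hpaired, hτdef, if_pos rfl]
    ring
  have hcore := sum_le_sum fun s (_ : s ∈ univ) => placed_pairedTotal_le_of_mul_le (k := k) hB
    (hF0 s) (hG0 s) (hC s) hc hl hD hD'
  have hsum : ∑ s, ∑ j : Fin k, ∑ σ : Position k B ↪ Fin n,
      singleTotal (placedChoice (F s) σ) (placedState (G s) false σ) j =
      k * (P * (N * (4 + τ)) / 15) := by
    have e : (1 + ε) * (2 * k + 2) - 2 * ((k : ℝ) - 1) = 4 + τ := by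
      rw [hτdef]; ring
    rw [← e, sum_comm, sum_congr rfl fun j _ => (eq_div_of_mul_eq (by norm_num)
      ((mul_comm _ _).trans (hsingle j))), sum_const, card_univ, Fintype.card_fin, nsmul_eq_mul]
  simp only [sum_add_distrib, ← mul_sum, hp0, hp1, hsum, sum_const, card_univ, Fintype.card_fin,
    nsmul_eq_mul, ← hP, ← hN] at hcore
  set E := Real.exp (-(k * c)) with hE
  have hk0 : (0 : ℝ) < k := Nat.cast_pos.2 hk
  have hW : 0 < k * P * N := by positivity
  have hkey : k * P * N * (49 / 50 * (2 + τ)) ≤ k * P * N *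
      (r * E * (4 * k + 4) + 10 ^ 4 * τ + (15 / 200 + 2 / 5 * (256 / 15)) * ((4 + τ) / 15)) := by
    linarith
  have hkey' := le_of_mul_le_mul_left hkey hW
  have hEinv : Real.exp (k * c) * E = 1 := by
    rw [hE, ← Real.exp_add, add_neg_cancel, Real.exp_zero]
  -- The left side of `hkey'` is at least 1.96; on the right, the terms without `r` sum to about
  -- 1.84 plus at most about 0.01 from `τ ≤ 1 / 10 ^ 6`. The gap exceeds `1/10`.
  have hfin : 1 ≤ 10 * (r * E * (4 * k + 4)) := by linarith
  calc Real.exp (k * c) = Real.exp (k * c) * 1 := (mul_one _).symm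
    _ ≤ Real.exp (k * c) * (10 * (r * E * (4 * k + 4))) :=
        mul_le_mul_of_nonneg_left hfin (Real.exp_pos _).le
    _ = Real.exp (k * c) * E * (10 * (r * (4 * k + 4))) := by ring
    _ = _ := by rw [hEinv, one_mul]

end Factorization

/-! ### Numerical choice of the parameters. -/

section Parameters

/-- Here `L` is `log B`, with `c = L / 160000`, `l = L / 2` and `D = 2050 * L`. The first inequality
reads `L / 4 + 40200 ≤ L / 2`, which is where 160800 comes from; in the last one `8195 / 4 < 2050`.
-/
lemma entropy_parameters {L : ℝ} (hL : 160800 ≤ L) :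
    200 * (200 * (L / 160000 + 1) + 1) ≤ L / 2 ∧ 2050 * L * Real.exp (L / 2) ≤ Real.exp L ∧
      1 + 8195 * (200 * (200 * (L / 160000))) ≤ 2050 * L := by
  refine ⟨by linarith, ?_, by linarith⟩
  have h1 := Real.quadratic_le_exp_of_nonneg (x := L / 2) (by linarith)
  have h2 : 2050 * L ≤ Real.exp (L / 2) := by nlinarith
  calc 2050 * L * Real.exp (L / 2) ≤ Real.exp (L / 2) * Real.exp (L / 2) :=
        mul_le_mul_of_nonneg_right h2 (Real.exp_pos _).le
    _ = Real.exp L := by rw [← Real.exp_add, add_halves]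

/-- Of the three factors `B ^ N`, one absorbs the polynomial prefactor, one absorbs `(18 * q) ^ N`
and one is needed as it stands. -/
lemma mul_pow_le_pow_three_mul {q m B : ℝ} (hq : 1 ≤ q) {N : ℕ} (hN : 0 < N) (hm : m = N)
    (hB : 160 * q ≤ B) : 10 * (4 * (q * m) + 4) * (18 * q * B) ^ N ≤ B ^ (3 * N) := by
  have hm1 : 1 ≤ m := by
    rw [hm]
    exact_mod_cast hN
  have h1 : (18 * q) ^ N ≤ B ^ N := pow_le_pow_left₀ (by linarith) (by linarith) N
  have h2 : 80 * q * m ≤ B ^ N := by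
    have h3 : m ≤ 2 ^ N := by
      rw [hm]
      exact_mod_cast Nat.lt_two_pow_self.le
    calc 80 * q * m ≤ (80 * q) ^ N * 2 ^ N :=
          mul_le_mul (le_self_pow₀ (by linarith) hN.ne') h3 (by linarith) (by positivity)
      _ = (160 * q) ^ N := by rw [← mul_pow]; ring
      _ ≤ B ^ N := pow_le_pow_left₀ (by linarith) hB N
  have h4 : 10 * (4 * (q * m) + 4) ≤ 80 * q * m := by nlinarith
  have hB0 : 0 ≤ B := by linarith
  calc 10 * (4 * (q * m) + 4) * (18 * q * B) ^ N
      = 10 * (4 * (q * m) + 4) * ((18 * q) ^ N * B ^ N) := by rw [mul_pow (18 * q) B]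
    _ ≤ B ^ N * (B ^ N * B ^ N) :=
        mul_le_mul (h4.trans h2) (mul_le_mul_of_nonneg_right h1 (by positivity)) (by positivity)
          (by positivity)
    _ = B ^ (3 * N) := by ring

lemma choose_le_mul_pow {n m : ℕ} {X : ℝ} (hX : 0 ≤ X) (h : (n : ℝ) ≤ X * m) :
    (n.choose m : ℝ) ≤ (3 * X) ^ m := by
  have h1 : (n.choose m : ℝ) ≤ (n : ℝ) ^ m / (m.factorial : ℝ) := Nat.choose_le_pow_div m n
  have h2 := Real.pow_div_factorial_le_exp (m : ℝ) (Nat.cast_nonneg m) m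
  have h3 : Real.exp (m : ℝ) ≤ 3 ^ m := by
    rw [← Real.exp_one_pow]
    exact pow_le_pow_left₀ (Real.exp_pos _).le (by linarith [Real.exp_one_lt_d9]) m
  calc (n.choose m : ℝ) ≤ (n : ℝ) ^ m / (m.factorial : ℝ) := h1
    _ ≤ (X * m) ^ m / (m.factorial : ℝ) := by gcongr
    _ = X ^ m * ((m : ℝ) ^ m / (m.factorial : ℝ)) := by rw [mul_pow, mul_div_assoc]
    _ ≤ X ^ m * 3 ^ m := by
        exact mul_le_mul_of_nonneg_left (h2.trans h3) (by positivity)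
    _ = (3 * X) ^ m := by rw [← mul_pow, mul_comm]

/-- The bound for many rows, in terms of the number of rows and the number of cells of a row. -/
lemma choose_le_card_factors {n m B r : ℕ} {K : Set (CompleteEdge n → ℝ)} {ε : ℝ} (hε : 0 ≤ ε)
    (h₁ : matchingPolytope n ⊆ K) (h₂ : K ⊆ (1 + ε) • matchingPolytope n)
    {g : Fin r → (CompleteEdge n → ℝ) → ℝ} (hg0 : ∀ t, ∀ x ∈ K, 0 ≤ g t x)
    (hg : ∀ (φ : (CompleteEdge n → ℝ) →ₗ[ℝ] ℝ) (b : ℝ), (∀ x ∈ K, 0 ≤ b + φ x) →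
      ∃ a : Fin r → ℝ, (∀ t, 0 ≤ a t) ∧ ∀ x ∈ K, b + φ x = ∑ t, a t * g t x)
    (hm : 0 < m) (hB : Real.exp 160800 ≤ B) (hB' : 160 * 480000 ≤ B)
    (hn : 2 * (480000 * m * B) + 3 ≤ n) (hn' : n ≤ 6 * 480000 * B * m)
    (hτ : ε * (2 * (480000 * m) + 2) ≤ 1 / 10 ^ 6) : n.choose m ≤ r := by
  have hBpos : (0 : ℝ) < B := (Real.exp_pos _).trans_le hB
  have hL : 160800 ≤ Real.log B := (Real.le_log_iff_exp_le hBpos).2 hB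
  obtain ⟨hl, hD, hD'⟩ := entropy_parameters hL
  rw [Real.exp_log hBpos] at hD
  have h := exp_le_card_factors (k := 480000 * m) (B := B) hε h₁ h₂ hg0 hg (by positivity)
    (by exact_mod_cast hBpos) hn (by push_cast; exact hτ) (by linarith) hl hD hD'
  -- With `480000 * m` rows the exponent `k * c` is exactly `3 * m * log B`.
  have he : Real.exp ((480000 * m : ℕ) * (Real.log B / 160000)) = (B : ℝ) ^ (3 * m) := by
    rw [← Real.rpow_natCast, Real.rpow_def_of_pos hBpos]
    congr 1
    push_cast
    ring
  rw [he] at h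
  push_cast at h
  have h1 := choose_le_mul_pow (n := n) (m := m) (X := 6 * 480000 * B) (by positivity)
    (by exact_mod_cast hn')
  have h2 := mul_pow_le_pow_three_mul (q := 480000) (m := m) (B := B) (by norm_num) hm rfl
    (by exact_mod_cast hB')
  have h3 : (3 * (6 * 480000 * B) : ℝ) ^ m = (18 * 480000 * B) ^ m := by ring
  rw [h3] at h1
  have hA : (0 : ℝ) < 10 * (4 * (480000 * m) + 4) := by positivity
  have h4 : 10 * (4 * (480000 * m) + 4) * (n.choose m : ℝ) ≤
      10 * (4 * (480000 * m) + 4) * (r : ℝ) :=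
    calc _ ≤ _ := mul_le_mul_of_nonneg_left h1 hA.le
      _ ≤ _ := h2
      _ ≤ _ := h
      _ = _ := by ring
  exact_mod_cast le_of_mul_le_mul_left h4 hA

end Parameters

/-! ### Choice of `α` and conclusion. -/

theorem theorem1p2 :
    ∃ α : ℝ, 0 < α ∧ α < 1 ∧
      ∀ (n : ℕ) (ε : ℝ), 0 < n → 2 / (n : ℝ) ≤ ε → ε ≤ 1 →
        ∀ K : Set (CompleteEdge n → ℝ), IsPolytope K →
          matchingPolytope n ⊆ K → K ⊆ (1 + ε) • matchingPolytope n →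
            ((n.choose ⌈α / ε⌉₊ : ℕ) : ℕ∞) ≤ extensionComplexity K := by
  obtain ⟨B₀, hB₀exp, hB₀q⟩ : ∃ B₀ : ℕ, Real.exp 160800 ≤ B₀ ∧ 160 * 480000 ≤ B₀ :=
    ⟨max ⌈Real.exp 160800⌉₊ (160 * 480000),
      (Nat.le_ceil _).trans (Nat.cast_le.2 (le_max_left _ _)), le_max_right _ _⟩
  have hB₀1 : (1 : ℝ) ≤ B₀ := (Real.one_le_exp (by norm_num)).trans hB₀exp
  set α : ℝ := 1 / (10 ^ 7 * 480000 * B₀) with hα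
  have hα0 : 0 < α := by positivity
  have hαB : α * B₀ = 1 / (10 ^ 7 * 480000) := by
    rw [hα]
    field_simp
  have hαle : α ≤ 1 / (10 ^ 7 * 480000) := by
    rw [← hαB]
    exact le_mul_of_one_le_right hα0.le hB₀1
  refine ⟨α, hα0, hαle.trans_lt (by norm_num), ?_⟩
  intro n ε hn hnε hε1 K _ h₁ h₂
  have hnR : (0 : ℝ) < n := Nat.cast_pos.2 hn
  have hε0 : 0 < ε := (by positivity : (0 : ℝ) < 2 / n).trans_le hnε
  have hεn : 2 ≤ ε * n := (div_le_iff₀ hnR).1 hnε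
  have hn2 : 2 ≤ n := by
    have : (2 : ℝ) ≤ n := hεn.trans (mul_le_of_le_one_left hnR.le hε1)
    exact_mod_cast this
  refine le_iInf fun d => le_iInf fun Q => le_iInf fun π => le_iInf fun hQ => ?_
  obtain ⟨r, g, hr, hg0, hg⟩ := hQ.exists_factorization
  have hnr : n ≤ r := le_card_factors hε0.le h₁ h₂ hn hg
  -- The degenerate alternative `r ≤ 1` is excluded by `2 ≤ n ≤ r`.
  refine le_trans ?_ (hr.resolve_right (by omega))
  rw [Nat.cast_le]
  set m := ⌈α / ε⌉₊ with hm
  have hm0 : 0 < m := Nat.ceil_pos.2 (by positivity)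
  by_cases hcase : α / ε ≤ 1
  · have hm1 : m = 1 := le_antisymm (Nat.ceil_le.2 (by exact_mod_cast hcase)) hm0
    rw [hm1, Nat.choose_one_right]
    exact hnr
  rw [not_le] at hcase
  have hεα : ε < α := (one_lt_div hε0).1 hcase
  have hm2 : (m : ℝ) ≤ 2 * (α / ε) := by
    have := Nat.ceil_lt_add_one (a := α / ε) (by positivity)
    linarith
  have hmε : ε * m ≤ 2 * α := by
    calc ε * m ≤ ε * (2 * (α / ε)) := mul_le_mul_of_nonneg_left hm2 hε0.le
      _ = 2 * α := by field_simp
  -- This is where `2 / n ≤ ε` enters: it leaves room for `480000 * m` rows of at least `B₀` cells.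
  have hmn : (m : ℝ) ≤ α * n := by
    have h1 : 2 * (m : ℝ) ≤ 2 * α * n := by
      calc 2 * (m : ℝ) ≤ ε * n * m := mul_le_mul_of_nonneg_right hεn (Nat.cast_nonneg m)
        _ = ε * m * n := by ring
        _ ≤ 2 * α * n := mul_le_mul_of_nonneg_right hmε hnR.le
    linarith
  have hn6 : (6 : ℝ) ≤ n := by
    have h1 : (1 : ℝ) ≤ m := by exact_mod_cast hm0
    have h2 : α * n ≤ 1 / (10 ^ 7 * 480000) * n := mul_le_mul_of_nonneg_right hαle hnR.le
    linarith
  have hlarge : 2 * (480000 * m * B₀) + 3 ≤ n := by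
    have h1 : (m : ℝ) * B₀ ≤ 1 / (10 ^ 7 * 480000) * n := by
      calc (m : ℝ) * B₀ ≤ α * n * B₀ := mul_le_mul_of_nonneg_right hmn (by linarith)
        _ = α * B₀ * n := by ring
        _ = _ := by rw [hαB]
    have h2 : (2 * (480000 * m * B₀) + 3 : ℝ) ≤ n := by linarith
    exact_mod_cast h2
  have hq : 0 < 2 * (480000 * m) := by positivity
  -- The largest row length that fits; its maximality yields `n ≤ 6 * 480000 * B * m`, so that `B`
  -- is comparable to `n / m`.
  obtain ⟨B, hB⟩ : ∃ B, B = (n - 3) / (2 * (480000 * m)) := ⟨_, rfl⟩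
  have hBB : B₀ ≤ B := hB ▸ (Nat.le_div_iff_mul_le hq).2 (by
    have : B₀ * (2 * (480000 * m)) = 2 * (480000 * m * B₀) := by ring
    omega)
  have hBexp : Real.exp 160800 ≤ B := hB₀exp.trans (Nat.cast_le.2 hBB)
  have hB1 : 160 * 480000 ≤ B := hB₀q.trans hBB
  have hlow : B * (2 * (480000 * m)) ≤ n - 3 := hB ▸ Nat.div_mul_le_self _ _
  have hup : n - 3 < B * (2 * (480000 * m)) + 2 * (480000 * m) := hB ▸ Nat.lt_div_mul_add hq
  have hmB : m ≤ B * m := Nat.le_mul_of_pos_left m (by omega)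
  refine choose_le_card_factors (B := B) hε0.le h₁ h₂ hg0 hg hm0 hBexp hB1 ?_ ?_ ?_
  · have : B * (2 * (480000 * m)) = 2 * (480000 * m * B) := by ring
    omega
  · have e1 : B * (2 * (480000 * m)) = 960000 * (B * m) := by ring
    have e2 : 6 * 480000 * B * m = 2880000 * (B * m) := by ring
    omega
  · have e : ε * (2 * (480000 * m) + 2) = 960000 * (ε * m) + 2 * ε := by ring
    rw [e]
    linarith
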